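/- Let $k$ be an arbitrary field, let $p,q$ be relatively prime positive integers, and let $(L_m)_{m\ge 0}$ be the $(p,q)$-Lucas sequence: $L_0=2$, $L_1=p$ and $L_{m+2}=p\,L_{m+1}+q\,L_m$ for $m\ge 0$. Let $a,d\ge 1$ and $n\ge 3$ be integers, and put $d_i:=L_{a+(i-1)d}$ for $1\le i\le n$ and $\mathcal A:=\{d_1,\dots,d_n\}$. Let $I_{\mathcal A}$ be the toric ideal of $\mathcal A$, i.e. the kernel of the $k$-algebra homomorphism $k[x_1,\dots,x_n]\to k[t]$, $x_i\mapsto t^{d_i}$. It is called a complete intersection if its minimal number of generators equals its height. For a positive integer $m$ let $[m]_2:=\max\{s\ge 0 : 2^s\mid m\}$. Then $I_{\mathcal A}$ is a complete intersection if and only if at least one of the following holds: (a) $d$ is odd; (b) $d\ge a$; (c) $\gcd(a,d)=a-d$ and $[d]_2>[a]_2\ge 1$; (d) $n=3$, $p$ is odd, $a/d$ is an odd integer, and $q$ is even; (e) $n=3$, $3\nmid d$, $p$ and $q$ are odd, and $a/d$ is an odd integer. -/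

import Mathlib

/-- The `(p,q)`-Lucas sequence: `L₀ = 2`, `L₁ = p`, `L_{m+2} = p L_{m+1} + q L_m`. -/
def lucasSeq (p q : ℕ) : ℕ → ℕ
  | 0 => 2
  | 1 => p
  | m + 2 => p * lucasSeq p q (m + 1) + q * lucasSeq p q m

/-- The toric ideal of `d₁, …, dₙ` over `k`: the kernel of the homomorphism of `k`-algebras
`k[x₁, …, xₙ] → k[t]`, `xᵢ ↦ t ^ dᵢ`. -/
noncomputable def toricIdeal (k : Type*) [Field k] {n : ℕ} (d : Fin n → ℕ) :
    Ideal (MvPolynomial (Fin n) k) :=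
  RingHom.ker (MvPolynomial.aeval (R := k) fun i => (Polynomial.X : Polynomial k) ^ d i)

/-- An ideal is a complete intersection if its minimal number of generators (`⊤` if it is not
finitely generated) equals its height. -/
def Ideal.IsCompleteIntersection {R : Type*} [CommRing R] (I : Ideal R) : Prop :=
  Cardinal.toENat (Submodule.spanRank I) = I.height

/-! Write `f i` for `L_{a+id}`, `P = L_d`, `Q = q^d`. Since the height of the ideal is `n - 1`,
being a complete intersection means having `n - 1` generators. The product formula `L_m L_{m+n} =
L_{2m+n} + (-q)^m L_n` gives `f (i+2) = P f (i+1) + Q f i` for odd `d` and `P f (i+1) = f (i+2) + Q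
f i` for even `d`. It also drives a Euclidean algorithm: `gcd(L_m, L_n)` is `L_g`, `g = gcd(m, n)`,
when `m/g` and `n/g` are odd, and divides 2 otherwise.

Sufficiency: in cases (a), (b), (c) every `f i` lies in the semigroup of `f 0` and `f 1`, by the
recurrence if `d` is odd and mostly by Sylvester's bound if `d` is even. One binomial then relates
`x_0` and `x_1`, and each further variable is eliminated by one more generator. For even `d`,
conditions (d) and (e) say that `n = 3`, `a/d` is odd and `P` is odd; the semigroup is then the
gluing of `f 0`, `f 2`, both divisible by `P`, with `f 1`, which is coprime to `P`.

Necessity: let `c_i` be the least positive multiplier putting `c_i D_i` in the semigroup of the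
other minimal degrees. If the numbers `c_i D_i` are pairwise distinct, the ideal needs as many
generators as there are variables (`curveHom.card_le_of_span_eq`). So in a complete intersection
`c_i D_i = c_j D_j` for some `i < j`, and `c_i` is at least `D_j / gcd(D_i, D_j)`. Outside (a)–(e),
known relations give smaller values of `c_i` or `c_j`; the size estimates rest on `lucasSeq.mul_lt`
and the gcd formula. -/

namespace lucasSeq

/-! ### Lucas numbers: product formula, growth and greatest common divisors. -/

variable {p q : ℕ}

theorem add_two (p q m : ℕ) :
    lucasSeq p q (m + 2) = p * lucasSeq p q (m + 1) + q * lucasSeq p q m := rfl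

theorem pos (hp : 0 < p) : ∀ m, 0 < lucasSeq p q m
  | 0 => by simp [lucasSeq]
  | 1 => by simpa [lucasSeq] using hp
  | m + 2 => by
    rw [add_two]
    have := pos hp (m + 1)
    positivity

theorem lt_succ (hp : 0 < p) (hq : 0 < q) {m : ℕ} (hm : 1 ≤ m) :
    lucasSeq p q m < lucasSeq p q (m + 1) := by
  obtain ⟨m, rfl⟩ := Nat.exists_eq_add_of_le' hm
  have h1 := pos (q := q) hp m
  have h2 : 0 < q * lucasSeq p q m := by positivity
  rw [add_two]
  nlinarith [Nat.le_mul_of_pos_left (lucasSeq p q (m + 1)) hp]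

theorem lt_of_lt (hp : 0 < p) (hq : 0 < q) {m n : ℕ} (hm : 1 ≤ m) (hmn : m < n) :
    lucasSeq p q m < lucasSeq p q n := by
  induction n, hmn using Nat.le_induction with
  | base => exact lt_succ hp hq hm
  | succ n hn ih => exact ih.trans (lt_succ hp hq (by omega))

theorem le_of_le (hp : 0 < p) (hq : 0 < q) {m n : ℕ} (hm : 1 ≤ m) (hmn : m ≤ n) :
    lucasSeq p q m ≤ lucasSeq p q n := by
  rcases hmn.eq_or_lt with rfl | h
  · rfl
  · exact (lt_of_lt hp hq hm h).le

theorem two_mul_lt (hp : 0 < p) (hq : 0 < q) {m n : ℕ} (hm : 1 ≤ m) (h : m + 2 ≤ n) :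
    2 * lucasSeq p q m < lucasSeq p q n := by
  refine lt_of_lt_of_le ?_ (le_of_le hp hq (by omega) h)
  have h1 := lt_succ hp hq hm
  rw [add_two]
  nlinarith [Nat.le_mul_of_pos_left (lucasSeq p q (m + 1)) hp,
    Nat.le_mul_of_pos_left (lucasSeq p q m) hq]

/-- The product formula `L_m L_{m+n} = L_{2m+n} + (-q)^m L_n`. -/
theorem mul_add (p q m : ℕ) : ∀ n, (lucasSeq p q m * lucasSeq p q (m + n) : ℤ) =
    lucasSeq p q (2 * m + n) + (-q : ℤ) ^ m * lucasSeq p q n := by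
  induction m using Nat.twoStepInduction with
  | zero => intro n; simp [lucasSeq]; ring
  | one =>
    intro n
    have h : 2 * 1 + n = n + 2 := by ring
    rw [h, add_two, Nat.add_comm 1 n]
    simp [lucasSeq]
  | more m h0 h1 =>
    intro n
    have e0 := h0 (n + 2)
    have e1 := h1 (n + 1)
    have a1 : m + 1 + (n + 1) = m + 2 + n := by ring
    have a2 : 2 * (m + 1) + (n + 1) = 2 * m + n + 3 := by ring
    have a3 : m + (n + 2) = m + 2 + n := by ring
    have a4 : 2 * m + (n + 2) = 2 * m + n + 2 := by ring
    have a5 : 2 * (m + 2) + n = 2 * m + n + 2 + 2 := by ring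
    rw [a1, a2] at e1
    rw [a3, a4] at e0
    rw [a5, add_two p q (2 * m + n + 2), add_two p q m]
    rw [add_two p q n] at e0
    push_cast at e0 ⊢
    linear_combination (p : ℤ) * e1 + (q : ℤ) * e0

theorem mul_add_of_even (p q : ℕ) {m : ℕ} (hm : Even m) (n : ℕ) :
    lucasSeq p q m * lucasSeq p q (m + n) =
      lucasSeq p q (2 * m + n) + q ^ m * lucasSeq p q n := by
  have := mul_add p q m n
  rw [hm.neg_pow] at this
  exact_mod_cast this

theorem mul_add_of_odd (p q : ℕ) {m : ℕ} (hm : Odd m) (n : ℕ) :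
    lucasSeq p q m * lucasSeq p q (m + n) + q ^ m * lucasSeq p q n =
      lucasSeq p q (2 * m + n) := by
  have := mul_add p q m n
  rw [hm.neg_pow] at this
  zify
  linear_combination this

theorem pow_mul_le (p q m n : ℕ) :
    q ^ m * lucasSeq p q n ≤ lucasSeq p q (2 * m + n) := by
  induction m with
  | zero => simp
  | succ m ih =>
    have h : 2 * (m + 1) + n = 2 * m + n + 2 := by ring
    rw [h, add_two, pow_succ]
    nlinarith [Nat.zero_le (p * lucasSeq p q (2 * m + n + 1))]

/-- An index beyond `g + m` dominates the product `L_g L_m`, provided that all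
indices have the same parity. -/
theorem mul_lt (hp : 0 < p) (hq : 0 < q) {g m M : ℕ} (hg : 1 ≤ g) (hm : 1 ≤ m)
    (h1 : g % 2 = M % 2) (h2 : m % 2 = M % 2) (h : g + m < M) :
    lucasSeq p q g * lucasSeq p q m < lucasSeq p q M := by
  wlog hgm : g ≤ m generalizing g m
  · rw [mul_comm]
    exact this hm hg h2 h1 (by omega) (by omega)
  obtain ⟨n, rfl⟩ := Nat.exists_eq_add_of_le hgm
  -- For even `g` the product is at most `2 L_{g+m}`, and parity forces `M ≥ g + m + 2`; for odd `g`
  -- the correction term has the favourable sign.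
  rcases Nat.even_or_odd g with he | ho
  · rw [mul_add_of_even p q he]
    have := pow_mul_le p q g n
    have h4 := two_mul_lt (p := p) (q := q) hp hq (m := 2 * g + n) (n := M) (by omega)
      (by rw [Nat.even_iff] at he; omega)
    omega
  · have := mul_add_of_odd p q ho n
    have h4 := lt_of_lt hp hq (m := 2 * g + n) (n := M) (by omega) (by omega)
    have h5 := Nat.zero_le (q ^ g * lucasSeq p q n)
    omega

theorem coprime_q (hpq : Nat.Coprime p q) {m : ℕ} (hm : 1 ≤ m) :
    Nat.Coprime (lucasSeq p q m) q := by
  induction m, hm using Nat.le_induction with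
  | base => simpa [lucasSeq] using hpq
  | succ m hm ih =>
    obtain ⟨m, rfl⟩ := Nat.exists_eq_add_of_le' hm
    rw [add_two]
    simpa using Nat.Coprime.mul_left hpq ih

/-- `L_g` divides `L_{rg}` for odd `r`. -/
theorem dvd_mul_of_odd (p q g : ℕ) {r : ℕ} (hr : Odd r) :
    lucasSeq p q g ∣ lucasSeq p q (g * r) := by
  obtain ⟨s, rfl⟩ := hr
  induction s with
  | zero => simp
  | succ s ih =>
    have h := mul_add p q g (g * (2 * s + 1))
    have e : 2 * g + g * (2 * s + 1) = g * (2 * (s + 1) + 1) := by ring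
    rw [e] at h
    zify at ih ⊢
    have : (lucasSeq p q (g * (2 * (s + 1) + 1)) : ℤ) =
      lucasSeq p q g * lucasSeq p q (g + g * (2 * s + 1)) -
        (-q : ℤ) ^ g * lucasSeq p q (g * (2 * s + 1)) := by linear_combination -h
    rw [this]
    exact dvd_sub (dvd_mul_right _ _) (ih.mul_left _)

/-- Modulo any divisor of `c`, `A` and `B` differ by a unit factor. This is one step of the
Euclidean algorithm below. -/
theorem gcd_eq_of_mul_eq_add {c A B u n : ℕ} {s : ℤ} (hu : Nat.Coprime c u)
    (h : (c : ℤ) * s = A + (-u : ℤ) ^ n * B) : Nat.gcd c A = Nat.gcd c B := by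
  apply Nat.dvd_antisymm
  · refine Nat.dvd_gcd (Nat.gcd_dvd_left _ _) ?_
    have h1 : (Nat.gcd c A : ℤ) ∣ (-u : ℤ) ^ n * B := by
      have : (-u : ℤ) ^ n * B = c * s - A := by linear_combination -h
      rw [this]
      exact dvd_sub (Dvd.dvd.mul_right (by exact_mod_cast Nat.gcd_dvd_left _ _) _)
        (by exact_mod_cast Nat.gcd_dvd_right _ _)
    have h2 : IsCoprime (Nat.gcd c A : ℤ) ((-u : ℤ) ^ n) := by
      refine IsCoprime.pow_right (IsCoprime.neg_right ?_)
      exact Nat.isCoprime_iff_coprime.2 (hu.coprime_dvd_left (Nat.gcd_dvd_left _ _))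
    exact_mod_cast h2.dvd_of_dvd_mul_left h1
  · refine Nat.dvd_gcd (Nat.gcd_dvd_left _ _) ?_
    have : (A : ℤ) = c * s - (-u : ℤ) ^ n * B := by linear_combination -h
    zify
    rw [this]
    exact dvd_sub (Dvd.dvd.mul_right (by exact_mod_cast Nat.gcd_dvd_left _ _) _)
      (Dvd.dvd.mul_left (by exact_mod_cast Nat.gcd_dvd_right _ _) _)

/-- Euclidean algorithm on indices: for `r < s` the product formula replaces `s` by `|s - 2r|`,
which preserves its parity. It ends at `(1, 1)`, with value `L_g`, or at an index `0`, where `L_0 =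
2`. -/
theorem gcd_mul_mul (hpq : Nat.Coprime p q) {g : ℕ} (hg : 0 < g) (N : ℕ) :
    ∀ r s, r + s = N → Nat.Coprime r s →
      (Odd r ∧ Odd s ∧ Nat.gcd (lucasSeq p q (g * r)) (lucasSeq p q (g * s)) = lucasSeq p q g) ∨
      (¬ (Odd r ∧ Odd s) ∧ Nat.gcd (lucasSeq p q (g * r)) (lucasSeq p q (g * s)) ∣ 2) := by
  induction N using Nat.strong_induction_on with
  | _ N ih =>
    intro r s hN hrs
    wlog hle : r ≤ s generalizing r s
    · have := this s r (by omega) hrs.symm (by omega)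
      rw [Nat.gcd_comm]
      tauto
    rcases Nat.eq_zero_or_pos r with rfl | hr
    · right
      refine ⟨by simp, ?_⟩
      have : lucasSeq p q (g * 0) = 2 := by simp [lucasSeq]
      rw [this]
      exact Nat.gcd_dvd_left _ _
    have hc : Nat.Coprime (lucasSeq p q (g * r)) q := coprime_q hpq (Nat.mul_pos hg hr)
    rcases hle.eq_or_lt with rfl | hlt
    · left
      have h1 : r = 1 := by simpa using hrs
      subst h1
      simp
    rcases le_total s (2 * r) with h2 | h2
    · obtain ⟨m, rfl⟩ := Nat.exists_eq_add_of_le hlt.le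
      obtain ⟨n, hn⟩ := Nat.exists_eq_add_of_le (show m ≤ r by omega)
      subst hn
      have h := mul_add p q (g * m) (g * n)
      have e1 : g * m + g * n = g * (m + n) := by ring
      have e2 : 2 * (g * m) + g * n = g * (m + n + m) := by ring
      rw [e1, e2, mul_comm] at h
      have hr' : Nat.Coprime (m + n) n := by
        have : Nat.Coprime (m + n) m := by simpa using hrs
        simpa [Nat.coprime_comm] using this
      have e := ih (m + n + n) (by omega) (m + n) n rfl hr'
      rw [gcd_eq_of_mul_eq_add hc h]
      have hpar : Odd (m + n + m) ↔ Odd n := by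
        rw [Nat.odd_iff, Nat.odd_iff]; omega
      rw [hpar]
      exact e
    · obtain ⟨n, rfl⟩ := Nat.exists_eq_add_of_le h2
      have h := mul_add p q (g * r) (g * n)
      have e2 : 2 * (g * r) + g * n = g * (2 * r + n) := by ring
      rw [e2] at h
      have hr' : Nat.Coprime r n := by
        have : 2 * r + n = n + 2 * r := by ring
        rw [this] at hrs
        simpa using hrs
      have e := ih (r + n) (by omega) r n rfl hr'
      rw [gcd_eq_of_mul_eq_add hc h]
      have hpar : Odd (2 * r + n) ↔ Odd n := by
        rw [Nat.odd_iff, Nat.odd_iff]; omega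
      rw [hpar]
      exact e

/-- The greatest common divisor of two Lucas numbers. -/
theorem gcd_eq (hpq : Nat.Coprime p q) {m n : ℕ} (hm : 0 < m) :
    (∃ r s, m = Nat.gcd m n * r ∧ n = Nat.gcd m n * s ∧ Odd r ∧ Odd s ∧
      Nat.gcd (lucasSeq p q m) (lucasSeq p q n) = lucasSeq p q (Nat.gcd m n)) ∨
    (∃ r s, m = Nat.gcd m n * r ∧ n = Nat.gcd m n * s ∧ ¬ (Odd r ∧ Odd s) ∧
      Nat.gcd (lucasSeq p q m) (lucasSeq p q n) ∣ 2) := by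
  have hg : 0 < Nat.gcd m n := Nat.gcd_pos_of_pos_left _ hm
  obtain ⟨g, r, s, hg', hrs, e1, e2⟩ := Nat.exists_coprime' hg
  have hg2 : Nat.gcd m n = g := by
    rw [e1, e2, Nat.gcd_mul_right, hrs.gcd_eq_one, one_mul]
  rw [hg2]
  rw [mul_comm] at e1 e2
  have := gcd_mul_mul (p := p) (q := q) hpq hg' (r + s) r s rfl hrs
  rw [← e1, ← e2] at this
  rcases this with ⟨h1, h2, h3⟩ | ⟨h1, h2⟩
  · exact Or.inl ⟨r, s, e1, e2, h1, h2, h3⟩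
  · exact Or.inr ⟨r, s, e1, e2, h1, h2⟩

end lucasSeq

/-! ### Monomial curves: normal forms and a lower bound for the number of generators. -/

open MvPolynomial in
/-- The homomorphism of `k`-algebras `k[xᵢ | i ∈ σ] → k[t]`, `xᵢ ↦ t ^ Dᵢ`. -/
noncomputable def curveHom (k : Type*) [Field k] {σ : Type*} (D : σ → ℕ) :
    MvPolynomial σ k →ₐ[k] Polynomial k :=
  MvPolynomial.aeval fun i => (Polynomial.X : Polynomial k) ^ D i

namespace curveHom

open MvPolynomial

variable {k : Type*} [Field k] {σ : Type*} {D : σ → ℕ}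

@[simp]
theorem apply_X (i : σ) : curveHom k D (X i) = Polynomial.X ^ D i := by
  simp [curveHom]

theorem apply_monomial (e : σ →₀ ℕ) (r : k) :
    curveHom k D (monomial e r) = Polynomial.monomial (Finsupp.weight D e) r := by
  rw [curveHom, aeval_monomial, Finsupp.weight_apply, ← Polynomial.C_mul_X_pow_eq_monomial,
    Finsupp.prod, Finsupp.sum, ← Finset.prod_pow_eq_pow_sum]
  simp [← pow_mul, mul_comm]

theorem monomial_sub_mem_ker {e e' : σ →₀ ℕ} (h : Finsupp.weight D e = Finsupp.weight D e') :
    monomial e (1 : k) - monomial e' 1 ∈ RingHom.ker (curveHom k D) := by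
  rw [RingHom.mem_ker, map_sub, apply_monomial, apply_monomial, h, sub_self]

/-- An element of the toric ideal cannot contain a monomial that is the only one of its degree. -/
theorem coeff_eq_zero_of_unique {f : MvPolynomial σ k} (hf : f ∈ RingHom.ker (curveHom k D))
    {e : σ →₀ ℕ}
    (he : ∀ e' ∈ f.support, Finsupp.weight D e' = Finsupp.weight D e → e' = e) :
    coeff e f = 0 := by
  classical
  by_contra hne
  rw [RingHom.mem_ker] at hf
  have h := congrArg (Polynomial.coeff · (Finsupp.weight D e)) hf
  simp only [Polynomial.coeff_zero] at h
  conv_lhs at h => rw [f.as_sum, map_sum, Polynomial.finsetSum_coeff]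
  rw [Finset.sum_eq_single e] at h
  · rw [apply_monomial, Polynomial.coeff_monomial, if_pos rfl] at h
    exact hne h
  · intro b hb hbe
    rw [apply_monomial, Polynomial.coeff_monomial, if_neg]
    exact fun h' => hbe (he b hb h')
  · intro h'
    rw [apply_monomial, notMem_support_iff.1 h']
    simp

/-- A subideal of the toric ideal modulo which every monomial can be brought to a normal form, with
different normal forms having different degrees, is the whole toric ideal. -/
theorem eq_ker_of_normalForm {J : Ideal (MvPolynomial σ k)} (hJ : J ≤ RingHom.ker (curveHom k D))
    {S : Set (σ →₀ ℕ)} (hinj : Set.InjOn (Finsupp.weight D) S)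
    (hred : ∀ e, ∃ e' ∈ S,
      Ideal.Quotient.mk J (monomial e 1) = Ideal.Quotient.mk J (monomial e' 1)) :
    J = RingHom.ker (curveHom k D) := by
  classical
  refine le_antisymm hJ fun f hf => ?_
  choose r hrS hr using hred
  set g : MvPolynomial σ k := ∑ e ∈ f.support, coeff e f • monomial (r e) 1 with hg
  have hfg : f - g ∈ J := by
    have : f = ∑ e ∈ f.support, coeff e f • monomial e 1 := by
      conv_lhs => rw [f.as_sum]
      refine Finset.sum_congr rfl fun e _ => ?_
      rw [smul_monomial, smul_eq_mul, mul_one]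
    rw [hg]
    nth_rewrite 1 [this]
    rw [← Finset.sum_sub_distrib]
    refine J.sum_mem fun e _ => ?_
    rw [← smul_sub, smul_eq_C_mul]
    exact J.mul_mem_left _ (Ideal.Quotient.eq.1 (hr e))
  have hgk : g ∈ RingHom.ker (curveHom k D) := by
    have := sub_mem hf (hJ hfg)
    simpa using this
  have hgS : ∀ e ∈ g.support, e ∈ S := by
    intro e he
    have h1 := support_sum he
    simp only [Finset.mem_biUnion] at h1
    obtain ⟨a, _, ha⟩ := h1
    rw [smul_monomial] at ha
    have := support_monomial_subset ha
    rw [Finset.mem_singleton] at this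
    exact this ▸ hrS a
  have hg0 : g = 0 := by
    ext e
    rw [coeff_zero]
    by_cases he : e ∈ g.support
    · exact coeff_eq_zero_of_unique hgk fun e' he' hw => hinj (hgS _ he') (hgS _ he) hw
    · exact notMem_support_iff.1 he
  rwa [hg0, sub_zero] at hfg

/-- Below the minimal exponent, `x_i^b` is alone in its degree: cancelling `x_i` from a second
monomial of that degree would express a smaller multiple of `D i` through the other degrees. -/
theorem coeff_single_eq_zero {f : MvPolynomial σ k} (hf : f ∈ RingHom.ker (curveHom k D))
    (hD : ∀ i, 0 < D i) {i : σ} {c b : ℕ} (hbc : b < c)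
    (hc : ∀ b', 0 < b' → b' < c → ¬ ∃ e : σ →₀ ℕ, e i = 0 ∧ Finsupp.weight D e = b' * D i) :
    coeff (Finsupp.single i b) f = 0 := by
  classical
  refine coeff_eq_zero_of_unique hf fun e _ he => ?_
  rw [Finsupp.weight_single, smul_eq_mul] at he
  have hsplit : e = e.erase i + Finsupp.single i (e i) := (Finsupp.erase_add_single i e).symm
  have hw : Finsupp.weight D (e.erase i) + e i * D i = b * D i := by
    rw [← he]
    conv_rhs => rw [hsplit]
    rw [map_add, Finsupp.weight_single, smul_eq_mul]
  have hle : e i ≤ b := by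
    by_contra h
    have := Nat.mul_lt_mul_of_pos_right (not_le.1 h) (hD i)
    omega
  rcases hle.eq_or_lt with h | h
  · have h0 : Finsupp.weight D (e.erase i) = 0 := by rw [h] at hw; omega
    have h1 : e.erase i = 0 := by
      rw [Finsupp.weight_apply, Finsupp.sum, Finset.sum_eq_zero_iff] at h0
      ext j
      by_contra hj
      have := h0 j (Finsupp.mem_support_iff.2 hj)
      rw [smul_eq_mul, mul_eq_zero] at this
      rcases this with h' | h'
      · exact hj h'
      · exact (hD j).ne' h'
    rw [hsplit, h1, zero_add, h]
  · refine absurd ⟨e.erase i, by simp, ?_⟩ (hc (b - e i) (by omega) (by omega))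
    rw [Nat.sub_mul]
    omega

/-- On the toric ideal, taking the coefficient of a minimal pure power is linear over the
polynomial ring acting through constant terms. -/
theorem coeff_single_mul {f : MvPolynomial σ k} (hf : f ∈ RingHom.ker (curveHom k D))
    (hD : ∀ i, 0 < D i) {i : σ} {c : ℕ}
    (hc : ∀ b', 0 < b' → b' < c → ¬ ∃ e : σ →₀ ℕ, e i = 0 ∧ Finsupp.weight D e = b' * D i)
    (h : MvPolynomial σ k) :
    coeff (Finsupp.single i c) (h * f) = constantCoeff h * coeff (Finsupp.single i c) f := by
  classical
  rw [coeff_mul, Finsupp.antidiagonal_single, Finset.sum_map]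
  rw [Finset.sum_eq_single (0, c)]
  · simp [constantCoeff_eq]
  · rintro ⟨a, b⟩ hab hne
    rw [Finset.HasAntidiagonal.mem_antidiagonal] at hab
    have hb : b < c := by
      rcases Nat.eq_zero_or_pos a with rfl | ha
      · exact absurd (by simp_all) hne
      · simp only at hab; omega
    simp [coeff_single_eq_zero hf hD hb hc]
  · intro h'
    simp at h'

/-- A lower bound for the number of generators of a toric ideal. Here `N` indexes a generating
subset of the degrees and `c i` is the least positive multiplier such that `c i * D i` is generated
by the degrees indexed by `N \ {i}`. -/
theorem card_le_of_span_eq [Fintype σ] (hD : ∀ i, 0 < D i) (N : Set σ)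
    (hN : ∀ i ∉ N, ∃ e : N →₀ ℕ, Finsupp.weight (fun j : N => D j) e = D i)
    (c : N → ℕ) (hc0 : ∀ i, 0 < c i)
    (hc1 : ∀ i, ∃ e : N →₀ ℕ, e i = 0 ∧ Finsupp.weight (fun j : N => D j) e = c i * D i)
    (hc2 : ∀ i b, 0 < b → b < c i →
      ¬ ∃ e : N →₀ ℕ, e i = 0 ∧ Finsupp.weight (fun j : N => D j) e = b * D i)
    (hne : ∀ i j : N, i ≠ j → c i * D i ≠ c j * D j)
    (s : Finset (MvPolynomial σ k)) (hs : Ideal.span (s : Set _) = RingHom.ker (curveHom k D)) :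
    Fintype.card σ ≤ s.card := by
  classical
  choose m hm using hN
  choose m' hm'0 hm' using hc1
  set DN : N → ℕ := fun j => D j with hDN
  have hDN0 : ∀ i, 0 < DN i := fun i => hD i
  -- Eliminates the redundant variables, replacing each by a monomial of the same degree, so that
  -- toric relations go to toric relations.
  set φ : MvPolynomial σ k →ₐ[k] MvPolynomial N k :=
    aeval fun j => if h : j ∈ N then X ⟨j, h⟩ else monomial (m j h) 1 with hφ
  have hφX : ∀ j : N, φ (X j) = X j := fun j => by simp [hφ]
  have hφX' : ∀ j (h : j ∉ N), φ (X j) = monomial (m j h) 1 := fun j h => by simp [hφ, h]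
  have hφr : ∀ f : MvPolynomial N k, φ (rename (↑) f) = f := by
    intro f
    have : φ.comp (rename ((↑) : N → σ)) = AlgHom.id k _ := by
      ext j : 1
      simp [hφX]
    exact congrArg (fun g : MvPolynomial N k →ₐ[k] MvPolynomial N k => g f) this
  have hφc : ∀ f, curveHom k DN (φ f) = curveHom k D f := by
    intro f
    have : (curveHom k DN).comp φ = curveHom k D := by
      ext j : 1
      by_cases h : j ∈ N
      · simp only [AlgHom.comp_apply, apply_X]
        rw [hφX ⟨j, h⟩, apply_X]
      · simp only [AlgHom.comp_apply, apply_X]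
        rw [hφX' j h, apply_monomial, hm, Polynomial.X_pow_eq_monomial]
    exact congrArg (fun g : MvPolynomial σ k →ₐ[k] Polynomial k => g f) this
  have hφ0 : ∀ f, constantCoeff (φ f) = constantCoeff f := by
    intro f
    have : (constantCoeff (R := k)).comp (φ : MvPolynomial σ k →+* MvPolynomial N k) =
        constantCoeff := by
      refine ringHom_ext (fun r => by simp) fun j => ?_
      simp only [RingHom.comp_apply, RingHom.coe_coe]
      by_cases h : j ∈ N
      · rw [hφX ⟨j, h⟩]; simp
      · rw [hφX' j h, constantCoeff_X, constantCoeff_monomial, if_neg]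
        intro h0
        have := hm j h
        rw [h0, map_zero] at this
        exact (hD j).ne this
    exact congrArg (fun g : MvPolynomial σ k →+* k => g f) this
  -- One functional per variable. Multipliers act on `Λ` of the toric ideal through their constant
  -- terms, so the images of any generating set span the image of the ideal.
  set Λ : MvPolynomial σ k →ₗ[k] (σ → k) := LinearMap.pi fun j =>
    if h : j ∈ N then (lcoeff k (Finsupp.single ⟨j, h⟩ (c ⟨j, h⟩))).comp φ.toLinearMap
    else lcoeff k (Finsupp.single j 1) with hΛ
  have hΛN : ∀ f (j : N), Λ f j = coeff (Finsupp.single j (c j)) (φ f) := fun f j => by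
    simp [hΛ, lcoeff]
  have hΛN' : ∀ f j, j ∉ N → Λ f j = coeff (Finsupp.single j 1) f := fun f j h => by
    simp [hΛ, h, lcoeff]
  have hΛmul : ∀ h, ∀ f ∈ RingHom.ker (curveHom k D), Λ (h * f) = constantCoeff h • Λ f := by
    intro h f hf
    ext j
    rw [Pi.smul_apply, smul_eq_mul]
    by_cases hj : j ∈ N
    · rw [hΛN _ ⟨j, hj⟩, hΛN _ ⟨j, hj⟩, map_mul, ← hφ0]
      refine coeff_single_mul ?_ hDN0 (hc2 ⟨j, hj⟩) _
      rw [RingHom.mem_ker] at hf ⊢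
      rw [hφc, hf]
    · rw [hΛN' _ _ hj, hΛN' _ _ hj]
      exact coeff_single_mul hf hD (fun b h1 h2 => by omega) _
  have hspan : ∀ f ∈ RingHom.ker (curveHom k D), Λ f ∈ Submodule.span k (s.image Λ : Set _) := by
    intro f hf
    rw [← hs] at hf hΛmul
    refine Submodule.span_induction
      (p := fun f _ => Λ f ∈ Submodule.span k (s.image Λ : Set _)) ?_ ?_ ?_ ?_ hf
    · intro x hx
      refine Submodule.subset_span ?_
      rw [Finset.coe_image]
      exact Set.mem_image_of_mem _ hx
    · simp
    · intro x y _ _ hx hy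
      rw [map_add]
      exact add_mem hx hy
    · intro a x hxs hx
      rw [smul_eq_mul, hΛmul a x hxs]
      exact Submodule.smul_mem _ _ hx
  -- The dual elements are `x_i^{c_i} - m'_i` for `i ∈ N` and `x_i - m_i` for the redundant
  -- variables.
  have hbasis : ∀ i, ∃ f ∈ RingHom.ker (curveHom k D), Λ f = Pi.single i 1 := by
    have hren : ∀ (i : σ) (f : MvPolynomial N k), i ∉ N →
        coeff (Finsupp.single i 1) (rename ((↑) : N → σ) f) = 0 := by
      intro i f hi
      refine coeff_rename_eq_zero _ _ _ fun u hu => ?_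
      exfalso
      have h1 := congrArg (fun e : σ →₀ ℕ => e i) hu
      simp only [Finsupp.single_eq_same] at h1
      rw [Finsupp.mapDomain_of_notMem_range _ _ (by simpa using hi)] at h1
      exact zero_ne_one h1
    have hrc : ∀ f : MvPolynomial N k, curveHom k D (rename (↑) f) = curveHom k DN f := by
      intro f
      rw [← hφc, hφr]
    intro i
    by_cases hi : i ∈ N
    · set i' : N := ⟨i, hi⟩ with hi'
      refine ⟨rename (↑) (monomial (Finsupp.single i' (c i')) (1 : k) - monomial (m' i') 1),
        ?_, ?_⟩
      · rw [RingHom.mem_ker, hrc, ← RingHom.mem_ker]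
        refine monomial_sub_mem_ker ?_
        rw [hm', Finsupp.weight_single, smul_eq_mul]
      · ext j
        by_cases hj : j ∈ N
        · set j' : N := ⟨j, hj⟩ with hj'
          rw [hΛN _ j', hφr, coeff_sub, coeff_monomial, coeff_monomial]
          -- The only use of `hne`: a coincidence of degrees could make the second monomial itself
          -- one of the detected pure powers.
          have h2 : m' i' ≠ Finsupp.single j' (c j') := by
            intro h
            by_cases hij : i' = j'
            · have := hm'0 i'
              rw [h, hij, Finsupp.single_eq_same] at this
              exact (hc0 j').ne' this
            · have := hm' i'
              rw [h, Finsupp.weight_single, smul_eq_mul] at this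
              exact hne i' j' hij this.symm
          rw [if_neg h2, sub_zero]
          by_cases hij : i = j
          · subst hij
            simp [hi', hj']
          · rw [Pi.single_eq_of_ne (Ne.symm hij), if_neg]
            intro h
            rw [Finsupp.single_eq_single_iff] at h
            rcases h with ⟨h, _⟩ | ⟨h, _⟩
            · exact hij (congrArg Subtype.val h)
            · exact (hc0 i').ne' h
        · rw [hΛN' _ _ hj, hren _ _ hj, Pi.single_eq_of_ne]
          rintro rfl
          exact hj hi
    · refine ⟨X i - rename (↑) (monomial (m i hi) (1 : k)), ?_, ?_⟩
      · rw [RingHom.mem_ker, map_sub, hrc, apply_X, apply_monomial, hm,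
          Polynomial.X_pow_eq_monomial, sub_self]
      · ext j
        by_cases hj : j ∈ N
        · rw [hΛN _ ⟨j, hj⟩, map_sub, hφr, hφX' i hi, sub_self, coeff_zero, Pi.single_eq_of_ne]
          rintro rfl
          exact hi hj
        · rw [hΛN' _ _ hj, coeff_sub, hren _ _ hj, sub_zero, coeff_X]
          by_cases hij : i = j
          · subst hij
            simp
          · rw [Pi.single_eq_of_ne (Ne.symm hij), if_neg]
            intro h
            rw [Finsupp.single_eq_single_iff] at h
            rcases h with ⟨h, _⟩ | ⟨h, _⟩
            · exact hij h
            · exact one_ne_zero h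
  have htop : Submodule.span k (s.image Λ : Set (σ → k)) = ⊤ := by
    rw [eq_top_iff, ← (Pi.basisFun k σ).span_eq, Submodule.span_le]
    rintro _ ⟨i, rfl⟩
    obtain ⟨f, hf, hfi⟩ := hbasis i
    rw [Pi.basisFun_apply, SetLike.mem_coe, ← hfi]
    exact hspan f hf
  have h1 := finrank_span_finset_le_card (R := k) (s.image Λ)
  rw [Set.finrank, htop, finrank_top, Module.finrank_fintype_fun_eq_card] at h1
  exact h1.trans Finset.card_image_le

end curveHom

/-! ### The height of the toric ideal. -/

namespace curveHom

open MvPolynomial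

variable {k : Type*} [Field k] {n : ℕ} {D : Fin n → ℕ}

instance isPrime_ker {σ : Type*} (D : σ → ℕ) : (RingHom.ker (curveHom k D)).IsPrime :=
  RingHom.ker_isPrime _

/-- The homomorphism substituting `t ^ D i` for the variables `x_i` with `i ≤ j` only. -/
noncomputable def partialHom (k : Type*) [Field k] {n : ℕ} (D : Fin n → ℕ) (j : ℕ) :
    MvPolynomial (Fin n) k →ₐ[k] MvPolynomial (Fin n) (Polynomial k) :=
  aeval fun i => if (i : ℕ) ≤ j then C (Polynomial.X ^ D i) else X i

/-- Specializing one more variable enlarges the prime kernel, and `x_{j+1}^{D 0} - x_0^{D (j+1)}`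
witnesses strictness. The resulting chain bounds the height from below. -/
theorem partialHom_ker_lt (hD : ∀ i, 0 < D i) {j : ℕ} (hj : j + 1 < n) :
    RingHom.ker (partialHom k D j) < RingHom.ker (partialHom k D (j + 1)) := by
  set ρ : MvPolynomial (Fin n) (Polynomial k) →ₐ[k] MvPolynomial (Fin n) (Polynomial k) :=
    (aeval (R := Polynomial k)
      fun i : Fin n => if (i : ℕ) = j + 1 then C (Polynomial.X ^ D i) else X i).restrictScalars k
    with hρ
  have hcomp : ρ.comp (partialHom k D j) = partialHom k D (j + 1) := by
    ext i : 1
    simp only [AlgHom.comp_apply, partialHom, aeval_X]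
    by_cases h1 : (i : ℕ) ≤ j
    · rw [if_pos h1, if_pos (by omega), hρ]
      simp
    · rw [if_neg h1, hρ]
      by_cases h2 : (i : ℕ) = j + 1
      · simp [h2]
      · have h3 : ¬ (i : ℕ) ≤ j + 1 := by omega
        simp [h2, h3]
  refine lt_of_le_of_ne ?_ ?_
  · intro f hf
    rw [RingHom.mem_ker] at hf ⊢
    rw [← hcomp, AlgHom.comp_apply, hf, map_zero]
  · intro heq
    set a : Fin n := ⟨0, by omega⟩
    set b : Fin n := ⟨j + 1, hj⟩
    have hmem : (X b ^ D a - X a ^ D b : MvPolynomial (Fin n) k) ∈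
        RingHom.ker (partialHom k D (j + 1)) := by
      rw [RingHom.mem_ker]
      simp only [partialHom, map_sub, map_pow, aeval_X]
      have h1 : (b : ℕ) ≤ j + 1 := le_rfl
      have h2 : (a : ℕ) ≤ j + 1 := Nat.zero_le _
      rw [if_pos h1, if_pos h2, ← pow_mul, ← pow_mul, mul_comm, sub_self]
    rw [← heq, RingHom.mem_ker] at hmem
    simp only [partialHom, map_sub, map_pow, aeval_X] at hmem
    have h1 : ¬ (b : ℕ) ≤ j := by simp [b]
    have h2 : (a : ℕ) ≤ j := Nat.zero_le _
    rw [if_neg h1, if_pos h2, ← C_pow, ← C_pow] at hmem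
    have h3 := congrArg (coeff (Finsupp.single b (D a))) hmem
    have h4 : (0 : Fin n →₀ ℕ) ≠ Finsupp.single b (D a) := by
      intro h
      have := congrArg (fun e : Fin n →₀ ℕ => e b) h
      simp only [Finsupp.coe_zero, Pi.zero_apply, Finsupp.single_eq_same] at this
      exact (hD a).ne this
    rw [coeff_sub, coeff_C, if_neg h4, sub_zero, coeff_zero, coeff_X_pow, if_pos rfl] at h3
    exact one_ne_zero h3

theorem le_height_partialHom_ker (hD : ∀ i, 0 < D i) :
    ∀ {j : ℕ}, j < n → (j : ℕ∞) ≤ (RingHom.ker (partialHom k D j)).height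
  | 0, _ => by simp
  | j + 1, hj => by
    have h1 := le_height_partialHom_ker hD (j := j) (by omega)
    have : (RingHom.ker (partialHom k D j)).IsPrime := RingHom.ker_isPrime _
    have h2 := Ideal.height_strict_mono_of_isPrime (partialHom_ker_lt (k := k) hD hj)
    rw [Nat.cast_add, Nat.cast_one]
    exact Order.add_one_le_of_lt (h1.trans_lt h2)

/-- The toric ideal of `n + 1` positive integers has height `n`. -/
theorem height_ker {n : ℕ} {D : Fin (n + 1) → ℕ} (hD : ∀ i, 0 < D i) :
    (RingHom.ker (curveHom k D)).height = n := by
  apply le_antisymm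
  -- The toric ideal lies strictly inside the maximal ideal of the origin, whose height is at most
  -- `n + 1`.
  · set m : Ideal (MvPolynomial (Fin (n + 1)) k) := RingHom.ker (constantCoeff (R := k)) with hm
    have hlt : RingHom.ker (curveHom k D) < m := by
      refine lt_of_le_of_ne ?_ ?_
      · intro f hf
        rw [hm, RingHom.mem_ker, constantCoeff_eq]
        have := coeff_single_eq_zero (i := 0) (c := 1) (b := 0) hf hD one_pos
          (fun b h1 h2 => by omega)
        simpa using this
      · intro heq
        have : (X 0 : MvPolynomial (Fin (n + 1)) k) ∈ m := by simp [hm, RingHom.mem_ker]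
        rw [← heq, RingHom.mem_ker, apply_X] at this
        exact pow_ne_zero _ Polynomial.X_ne_zero this
    have hmp : m.IsPrime := RingHom.ker_isPrime _
    have h1 := Ideal.height_strict_mono_of_isPrime hlt
    have h2 := Ideal.height_le_ringKrullDim_of_ne_top hmp.ne_top
    rw [MvPolynomial.ringKrullDim_of_isNoetherianRing, ringKrullDim_eq_zero_of_field,
      Nat.card_fin, zero_add] at h2
    have h3 : m.height ≤ ((n + 1 : ℕ) : ℕ∞) := by exact_mod_cast h2
    have h4 := h1.trans_le h3
    rw [Nat.cast_add, Nat.cast_one] at h4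
    exact Order.le_of_lt_add_one h4
  · refine (le_height_partialHom_ker hD (k := k) (Nat.lt_succ_self n)).trans
      (Ideal.height_mono ?_)
    intro f hf
    have hcomp : (partialHom k D n) =
        (IsScalarTower.toAlgHom k (Polynomial k)
          (MvPolynomial (Fin (n + 1)) (Polynomial k))).comp (curveHom k D) := by
      ext i : 1
      have : (i : ℕ) ≤ n := Nat.le_of_lt_succ i.2
      simp [partialHom, this, algebraMap_eq]
    rw [RingHom.mem_ker, hcomp, AlgHom.comp_apply, IsScalarTower.coe_toAlgHom',
      algebraMap_eq] at hf
    rw [RingHom.mem_ker]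
    exact C_injective _ _ (by rw [hf, map_zero])

end curveHom

/-! ### Counting generators, and two families of complete intersections. -/

section CompleteIntersection

open MvPolynomial

variable {k : Type*} [Field k]

theorem toricIdeal_isCompleteIntersection_iff {n : ℕ} {D : Fin (n + 1) → ℕ} (hD : ∀ i, 0 < D i) :
    (toricIdeal k D).IsCompleteIntersection ↔
      ∃ s : Finset (MvPolynomial (Fin (n + 1)) k), Ideal.span (s : Set _) = toricIdeal k D ∧
        s.card ≤ n := by
  have hh : (toricIdeal k D).height = n := curveHom.height_ker hD
  have hne : toricIdeal k D ≠ ⊤ := (curveHom.isPrime_ker (k := k) D).ne_top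
  unfold Ideal.IsCompleteIntersection
  constructor
  · intro h
    rw [hh, Submodule.spanRank_toENat_eq_iInf_finset_card, ENat.iInf_eq_natCast_iff] at h
    obtain ⟨⟨s, hs⟩, -⟩ := h
    exact ⟨s.1, s.2, by exact_mod_cast hs.le⟩
  · rintro ⟨s, hs, hcard⟩
    refine le_antisymm ?_ (Ideal.height_le_spanRank_toENat _ hne)
    rw [hh, Submodule.spanRank_toENat_eq_iInf_finset_card]
    exact (iInf_le _ ⟨s, hs⟩).trans (by exact_mod_cast hcard)

theorem MvPolynomial.monomial_single_add_single {σ : Type*} (i j : σ) (u v : ℕ) :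
    monomial (Finsupp.single i u + Finsupp.single j v) (1 : k) = X i ^ u * X j ^ v := by
  rw [X_pow_eq_monomial, X_pow_eq_monomial, monomial_mul, one_mul]

theorem Nat.eq_of_mul_add_mul_eq {A B u v u' v' : ℕ} (hAB : Nat.Coprime A B) (hA : 0 < A)
    (hu : u < A) (hu' : u' < A) (h : u * B + v * A = u' * B + v' * A) : u = u' ∧ v = v' := by
  have h1 : u = u' := by
    have h2 : u * B ≡ u' * B [MOD A] := by
      have := congrArg (· % A) h
      simpa [Nat.ModEq] using this
    exact (Nat.ModEq.cancel_right_of_coprime hAB h2).eq_of_lt_of_lt hu hu'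
  subst h1
  exact ⟨rfl, Nat.eq_of_mul_eq_mul_right hA (by omega)⟩

/-- If all degrees are generated by the first two of them, the toric ideal is a complete
intersection. -/
theorem toricIdeal_isCompleteIntersection_of_two {m : ℕ} {D : Fin (m + 2) → ℕ}
    (hD : ∀ i, 0 < D i) (h : ∀ i : Fin m, ∃ u v, u * D 0 + v * D 1 = D i.succ.succ) :
    (toricIdeal k D).IsCompleteIntersection := by
  classical
  rw [toricIdeal_isCompleteIntersection_iff hD]
  choose u v huv using h
  obtain ⟨g, B, A, hg, hBA, hB, hA⟩ := Nat.exists_coprime' (Nat.gcd_pos_of_pos_left (D 1) (hD 0))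
  have hA0 : 0 < A := Nat.pos_of_ne_zero fun h0 => (hD 1).ne' (by rw [hA, h0, zero_mul])
  set s : Finset (MvPolynomial (Fin (m + 2)) k) := insert (X 0 ^ A - X 1 ^ B)
    (Finset.univ.image fun i : Fin m => X i.succ.succ - X 0 ^ u i * X 1 ^ v i) with hs
  refine ⟨s, ?_, ?_⟩
  swap
  · refine (Finset.card_insert_le _ _).trans ?_
    have := Finset.card_image_le (s := (Finset.univ : Finset (Fin m)))
      (f := fun i => (X i.succ.succ - X 0 ^ u i * X 1 ^ v i : MvPolynomial (Fin (m + 2)) k))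
    rw [Finset.card_univ, Fintype.card_fin] at this
    omega
  set J := Ideal.span (s : Set (MvPolynomial (Fin (m + 2)) k)) with hJ
  have r1 : Ideal.Quotient.mk J (X 0) ^ A = Ideal.Quotient.mk J (X 1) ^ B := by
    rw [← map_pow, ← map_pow, Ideal.Quotient.eq]
    exact Ideal.subset_span (by simp [hs])
  have r2 : ∀ i : Fin m, Ideal.Quotient.mk J (X i.succ.succ) =
      Ideal.Quotient.mk J (X 0) ^ u i * Ideal.Quotient.mk J (X 1) ^ v i := by
    intro i
    rw [← map_pow, ← map_pow, ← map_mul, Ideal.Quotient.eq]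
    exact Ideal.subset_span (by simp [hs])
  -- Normal forms are `x_0^a x_1^b` with `a < A`; the degree determines `a` modulo `A`.
  refine curveHom.eq_ker_of_normalForm (D := D)
    (S := {e | ∃ a < A, ∃ b, e = Finsupp.single 0 a + Finsupp.single 1 b}) ?_ ?_ ?_
  · rw [hJ, Ideal.span_le]
    intro f hf
    rw [hs, Finset.coe_insert, Set.mem_insert_iff, Finset.coe_image] at hf
    rcases hf with rfl | ⟨i, -, rfl⟩
    · simp only [SetLike.mem_coe, RingHom.mem_ker, map_sub, map_pow, curveHom.apply_X]
      rw [← pow_mul, ← pow_mul, hA, hB, sub_eq_zero]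
      congr 1
      ring
    · simp only [SetLike.mem_coe, RingHom.mem_ker, map_sub, map_mul, map_pow, curveHom.apply_X]
      rw [← pow_mul, ← pow_mul, ← pow_add, sub_eq_zero, ← huv]
      congr 1
      ring
  · rintro _ ⟨a, ha, b, rfl⟩ _ ⟨a', ha', b', rfl⟩ hw
    simp only [map_add, Finsupp.weight_single, smul_eq_mul] at hw
    rw [hA, hB] at hw
    have h1 : a * B + b * A = a' * B + b' * A := by
      apply Nat.eq_of_mul_eq_mul_right hg
      linear_combination hw
    obtain ⟨rfl, rfl⟩ := Nat.eq_of_mul_add_mul_eq hBA.symm hA0 ha ha' h1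
    rfl
  · intro e
    have hcl : Ideal.Quotient.mk J (monomial e 1) ∈
        Submonoid.closure {Ideal.Quotient.mk J (X 0), Ideal.Quotient.mk J (X 1)} := by
      rw [monomial_eq, C_1, one_mul, Finsupp.prod, map_prod]
      refine Submonoid.prod_mem _ fun i _ => ?_
      rw [map_pow]
      refine Submonoid.pow_mem _ ?_ _
      refine Fin.cases ?_ (fun i => Fin.cases ?_ (fun i => ?_) i) i
      · exact Submonoid.subset_closure (by simp)
      · exact Submonoid.subset_closure (by simp)
      · rw [r2]
        exact Submonoid.mul_mem _ (Submonoid.pow_mem _ (Submonoid.subset_closure (by simp)) _)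
          (Submonoid.pow_mem _ (Submonoid.subset_closure (by simp)) _)
    rw [Submonoid.mem_closure_pair] at hcl
    obtain ⟨a, b, hab⟩ := hcl
    refine ⟨_, ⟨a % A, Nat.mod_lt _ hA0, b + B * (a / A), rfl⟩, ?_⟩
    rw [monomial_single_add_single, ← hab, map_mul, map_pow, map_pow, pow_add, pow_mul, ← r1,
      ← pow_mul]
    conv_lhs => rw [← Nat.mod_add_div a A, pow_add]
    ring

/-- The toric ideal of a gluing of two of three degrees with the third is a complete
intersection. -/
theorem toricIdeal_isCompleteIntersection_of_gluing {D : Fin 3 → ℕ} (hD : ∀ i, 0 < D i)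
    {P Q A B : ℕ} (h0 : D 0 = A * P) (h2 : D 2 = B * P) (h1 : P * D 1 = D 2 + Q * D 0)
    (hPD : Nat.Coprime P (D 1)) (hAB : Nat.Coprime A B) :
    (toricIdeal k D).IsCompleteIntersection := by
  classical
  rw [toricIdeal_isCompleteIntersection_iff hD]
  have hP0 : 0 < P := Nat.pos_of_ne_zero fun h => (hD 0).ne' (by rw [h0, h, mul_zero])
  have hB0 : 0 < B := Nat.pos_of_ne_zero fun h => (hD 2).ne' (by rw [h2, h, zero_mul])
  set s : Finset (MvPolynomial (Fin 3) k) :=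
    {X 0 ^ B - X 2 ^ A, X 1 ^ P - X 2 * X 0 ^ Q} with hs
  refine ⟨s, ?_, Finset.card_le_two⟩
  set J := Ideal.span (s : Set (MvPolynomial (Fin 3) k)) with hJ
  have r1 : Ideal.Quotient.mk J (X 0) ^ B = Ideal.Quotient.mk J (X 2) ^ A := by
    rw [← map_pow, ← map_pow, Ideal.Quotient.eq]
    exact Ideal.subset_span (by simp [hs])
  have r2 : Ideal.Quotient.mk J (X 1) ^ P =
      Ideal.Quotient.mk J (X 2) * Ideal.Quotient.mk J (X 0) ^ Q := by
    rw [← map_pow, ← map_pow, ← map_mul, Ideal.Quotient.eq]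
    exact Ideal.subset_span (by simp [hs])
  -- The degree modulo `P` determines the exponent of `x_1`; the remaining part, divided by `P`,
  -- determines that of `x_0` modulo `B`.
  refine curveHom.eq_ker_of_normalForm (D := D)
    (S := {e | ∃ a < B, ∃ b < P, ∃ c, e =
      Finsupp.single 0 a + Finsupp.single 2 c + Finsupp.single 1 b}) ?_ ?_ ?_
  · rw [hJ, Ideal.span_le]
    intro f hf
    rw [hs, Finset.coe_pair, Set.mem_insert_iff, Set.mem_singleton_iff] at hf
    rcases hf with rfl | rfl
    · simp only [SetLike.mem_coe, RingHom.mem_ker, map_sub, map_pow, curveHom.apply_X]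
      rw [← pow_mul, ← pow_mul, h0, h2, sub_eq_zero]
      congr 1
      ring
    · simp only [SetLike.mem_coe, RingHom.mem_ker, map_sub, map_mul, map_pow, curveHom.apply_X]
      rw [← pow_mul, ← pow_mul, ← pow_add, sub_eq_zero, mul_comm, h1]
      congr 1
      ring
  · rintro _ ⟨a, ha, b, hb, c, rfl⟩ _ ⟨a', ha', b', hb', c', rfl⟩ hw
    simp only [map_add, Finsupp.weight_single, smul_eq_mul] at hw
    rw [h0, h2] at hw
    obtain ⟨rfl, h⟩ := Nat.eq_of_mul_add_mul_eq (v := a * A + c * B) (v' := a' * A + c' * B)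
      hPD hP0 hb hb' (by linear_combination hw)
    obtain ⟨rfl, rfl⟩ := Nat.eq_of_mul_add_mul_eq hAB.symm hB0 ha ha' h
    rfl
  · intro e
    have he : Ideal.Quotient.mk J (monomial e 1) = Ideal.Quotient.mk J (X 0) ^ e 0 *
        Ideal.Quotient.mk J (X 1) ^ e 1 * Ideal.Quotient.mk J (X 2) ^ e 2 := by
      rw [monomial_eq, C_1, one_mul, Finsupp.prod_fintype _ _ (fun i => pow_zero _),
        Fin.prod_univ_three]
      simp only [map_mul, map_pow]
    set t := e 1 / P with ht
    refine ⟨_, ⟨(e 0 + Q * t) % B, Nat.mod_lt _ hB0, e 1 % P, Nat.mod_lt _ hP0,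
      e 2 + t + A * ((e 0 + Q * t) / B), rfl⟩, ?_⟩
    have hmon : ∀ a b c : ℕ, monomial (Finsupp.single 0 a + Finsupp.single 2 c +
        Finsupp.single 1 b) (1 : k) = X 0 ^ a * X 2 ^ c * X (1 : Fin 3) ^ b := by
      intro a b c
      rw [X_pow_eq_monomial, X_pow_eq_monomial, X_pow_eq_monomial, monomial_mul, monomial_mul,
        one_mul, one_mul]
    rw [he, hmon]
    simp only [map_mul, map_pow]
    have e1 : Ideal.Quotient.mk J (X 1) ^ e 1 = Ideal.Quotient.mk J (X 1) ^ (e 1 % P) *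
        (Ideal.Quotient.mk J (X 2) * Ideal.Quotient.mk J (X 0) ^ Q) ^ t := by
      rw [← r2, ← pow_mul, ← pow_add, Nat.mod_add_div]
    have e2 : Ideal.Quotient.mk J (X 0) ^ (e 0 + Q * t) =
        Ideal.Quotient.mk J (X 0) ^ ((e 0 + Q * t) % B) *
        (Ideal.Quotient.mk J (X 2) ^ A) ^ ((e 0 + Q * t) / B) := by
      rw [← r1, ← pow_mul, ← pow_add, Nat.mod_add_div]
    calc _ = Ideal.Quotient.mk J (X 0) ^ (e 0 + Q * t) * Ideal.Quotient.mk J (X 2) ^ (e 2 + t) *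
          Ideal.Quotient.mk J (X 1) ^ (e 1 % P) := by rw [e1]; ring
      _ = _ := by rw [e2]; ring

end CompleteIntersection

/-! ### Arithmetic of the progression, for the sufficient conditions. -/

/-- Sylvester's bound after division by the gcd. -/
theorem Nat.exists_mul_add_mul_eq_of_mul_le_gcd_mul {x y M : ℕ} (hx : 0 < x)
    (hdvd : Nat.gcd x y ∣ M) (hle : x * y ≤ Nat.gcd x y * M) : ∃ u v, u * x + v * y = M := by
  have hg : 0 < Nat.gcd x y := Nat.gcd_pos_of_pos_left _ hx
  obtain ⟨g, x', y', hg0, hxy, ex, ey⟩ := Nat.exists_coprime' hg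
  have hgg : Nat.gcd x y = g := by
    rw [ex, ey, Nat.gcd_mul_right, hxy.gcd_eq_one, one_mul]
  rw [hgg] at hdvd hle
  obtain ⟨M', rfl⟩ := hdvd
  obtain ⟨u, v, huv⟩ := Nat.exists_add_mul_eq_of_gcd_dvd_of_mul_pred_le x' y' M'
    (by rw [hxy.gcd_eq_one]; exact one_dvd _) (by
      have h1 : x' * y' ≤ M' := by
        rw [ex, ey] at hle
        refine Nat.le_of_mul_le_mul_left ?_ (Nat.mul_pos hg0 hg0)
        calc g * g * (x' * y') = x' * g * (y' * g) := by ring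
          _ ≤ g * (g * M') := hle
          _ = g * g * M' := by ring
      exact (Nat.mul_le_mul (Nat.pred_le _) (Nat.pred_le _)).trans h1)
  refine ⟨u, v, ?_⟩
  rw [ex, ey, ← huv]
  ring

namespace lucasSeq

variable {p q : ℕ}

theorem progression_of_even (p q a : ℕ) {d : ℕ} (hd : Even d) (i : ℕ) :
    lucasSeq p q d * lucasSeq p q (a + (i + 1) * d) =
      lucasSeq p q (a + (i + 2) * d) + q ^ d * lucasSeq p q (a + i * d) := by
  have h := mul_add_of_even p q hd (a + i * d)
  have e1 : d + (a + i * d) = a + (i + 1) * d := by ring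
  have e2 : 2 * d + (a + i * d) = a + (i + 2) * d := by ring
  rwa [e1, e2] at h

theorem progression_of_odd (p q a : ℕ) {d : ℕ} (hd : Odd d) (i : ℕ) :
    lucasSeq p q d * lucasSeq p q (a + (i + 1) * d) + q ^ d * lucasSeq p q (a + i * d) =
      lucasSeq p q (a + (i + 2) * d) := by
  have h := mul_add_of_odd p q hd (a + i * d)
  have e1 : d + (a + i * d) = a + (i + 1) * d := by ring
  have e2 : 2 * d + (a + i * d) = a + (i + 2) * d := by ring
  rwa [e1, e2] at h

theorem gcd_dvd_progression (p q a : ℕ) {d : ℕ} (hd : Even d) (i : ℕ) :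
    Nat.gcd (lucasSeq p q a) (lucasSeq p q (a + d)) ∣ lucasSeq p q (a + i * d) := by
  induction i using Nat.twoStepInduction with
  | zero => simpa using Nat.gcd_dvd_left _ _
  | one => simpa using Nat.gcd_dvd_right _ _
  | more i h0 h1 =>
    have h := progression_of_even p q a hd i
    exact (Nat.dvd_add_left (h0.mul_left _)).1 (h ▸ h1.mul_left _)

theorem exists_of_odd (p q a : ℕ) {d : ℕ} (hd : Odd d) (i : ℕ) :
    ∃ u v, u * lucasSeq p q a + v * lucasSeq p q (a + d) = lucasSeq p q (a + i * d) := by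
  induction i using Nat.twoStepInduction with
  | zero => exact ⟨1, 0, by simp⟩
  | one => exact ⟨0, 1, by simp⟩
  | more i h0 h1 =>
    obtain ⟨u0, v0, h0⟩ := h0
    obtain ⟨u1, v1, h1⟩ := h1
    refine ⟨lucasSeq p q d * u1 + q ^ d * u0, lucasSeq p q d * v1 + q ^ d * v0, ?_⟩
    rw [← progression_of_odd p q a hd i, ← h0, ← h1]
    ring

theorem exists_of_mul_le (hp : 0 < p) {a d i : ℕ} (hd : Even d)
    (h : lucasSeq p q a * lucasSeq p q (a + d) ≤
      Nat.gcd (lucasSeq p q a) (lucasSeq p q (a + d)) * lucasSeq p q (a + i * d)) :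
    ∃ u v, u * lucasSeq p q a + v * lucasSeq p q (a + d) = lucasSeq p q (a + i * d) :=
  Nat.exists_mul_add_mul_eq_of_mul_le_gcd_mul (pos hp _)
    (gcd_dvd_progression p q a hd i) h

theorem exists_of_even_of_le (hp : 0 < p) (hq : 0 < q) {a d : ℕ} (ha : 0 < a) (hd : Even d)
    (had : a ≤ d) (i : ℕ) :
    ∃ u v, u * lucasSeq p q a + v * lucasSeq p q (a + d) = lucasSeq p q (a + (i + 2) * d) := by
  -- The one case in which `a + (a + d) < a + (i + 2) * d` fails; there `L_a` divides `L_{3a}`.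
  by_cases h : a = d ∧ i = 0
  · obtain ⟨rfl, rfl⟩ := h
    obtain ⟨t, ht⟩ := dvd_mul_of_odd p q a (r := 3) (by decide)
    refine ⟨t, 0, ?_⟩
    have e : a + (0 + 2) * a = a * 3 := by ring
    rw [e, ht]
    ring
  · refine exists_of_mul_le hp hd ?_
    have he : ((i + 2) * d) % 2 = 0 := Nat.even_iff.1 (hd.mul_left _)
    have he' : d % 2 = 0 := Nat.even_iff.1 hd
    have hlt : a + (a + d) < a + (i + 2) * d := by
      have h1 : (i + 2) * d = i * d + 2 * d := by ring
      rcases Nat.eq_zero_or_pos i with rfl | hi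
      · have : a ≠ d := fun h' => h ⟨h', rfl⟩
        omega
      · have := Nat.le_mul_of_pos_left d hi
        omega
    have h2 := mul_lt hp hq (g := a) (m := a + d) (M := a + (i + 2) * d) (by omega) (by omega)
      (by omega) (by omega) hlt
    refine h2.le.trans (Nat.le_mul_of_pos_left _ (Nat.gcd_pos_of_pos_left _ (pos hp _)))

/-- Condition (c), with `d = ge` and `a = g(e+1)`. Here `L_g` divides the gcd of `f 0` and `f 1`,
and expanding `L_a L_{a+d}` and `L_g L_{a+2d}` gives the same leading term `L_{2a+d}`; the
corrections compare by `q^d L_d ≤ L_{3d}`. -/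
theorem exists_of_eq_add (hp : 0 < p) (hq : 0 < q) {g e : ℕ} (hg : Even g) (hg0 : 0 < g)
    (he : Even e) (i : ℕ) :
    ∃ u v, u * lucasSeq p q (g * e + g) + v * lucasSeq p q (g * e + g + g * e) =
      lucasSeq p q (g * e + g + (i + 2) * (g * e)) := by
  have hd : Even (g * e) := hg.mul_right _
  refine exists_of_mul_le hp hd ?_
  have h1 : lucasSeq p q g ∣
      Nat.gcd (lucasSeq p q (g * e + g)) (lucasSeq p q (g * e + g + g * e)) := by
    refine Nat.dvd_gcd ?_ ?_
    · exact dvd_mul_of_odd p q g (r := e + 1) he.add_one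
    · have e1 : g * e + g + g * e = g * (2 * e + 1) := by ring
      rw [e1]
      exact dvd_mul_of_odd p q g (by simp)
  have h2 : lucasSeq p q g ≤ _ := Nat.le_of_dvd (Nat.gcd_pos_of_pos_left _ (pos hp _)) h1
  have h3 : lucasSeq p q (g * e + g + 2 * (g * e)) ≤
      lucasSeq p q (g * e + g + (i + 2) * (g * e)) := by
    refine le_of_le hp hq (by omega) ?_
    exact Nat.add_le_add_left (Nat.mul_le_mul_right _ (by omega)) _
  refine le_trans ?_ (Nat.mul_le_mul h2 h3)
  have h4 := mul_add_of_even p q (hd.add hg) (g * e)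
  have h5 := mul_add_of_even p q hg (3 * (g * e))
  have e1 : g + 3 * (g * e) = g * e + g + 2 * (g * e) := by ring
  have e2 : 2 * g + 3 * (g * e) = 2 * (g * e + g) + g * e := by ring
  rw [e1, e2] at h5
  rw [h4, h5, pow_add, mul_comm (q ^ (g * e)), mul_assoc]
  refine Nat.add_le_add_left (Nat.mul_le_mul_left _ ?_) _
  have h6 := pow_mul_le p q (g * e) (g * e)
  have e3 : 2 * (g * e) + g * e = 3 * (g * e) := by ring
  rwa [e3] at h6

theorem even_of_even (hp : Even p) : ∀ m, Even (lucasSeq p q m) := by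
  intro m
  induction m using Nat.twoStepInduction with
  | zero => simp [lucasSeq]
  | one => simpa [lucasSeq] using hp
  | more m h0 h1 =>
    rw [add_two]
    exact (h1.mul_left _).add (h0.mul_left _)

theorem odd_of_even (hp : Odd p) (hq : Even q) (m : ℕ) : Odd (lucasSeq p q (m + 1)) := by
  induction m with
  | zero => simpa [lucasSeq] using hp
  | succ m ih =>
    rw [add_two]
    exact (hp.mul ih).add_even (hq.mul_right _)

theorem even_iff_three_dvd (hp : Odd p) (hq : Odd q) (m : ℕ) :
    Even (lucasSeq p q m) ↔ 3 ∣ m := by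
  have key : ∀ m, Even (lucasSeq p q (3 * m)) ∧ Odd (lucasSeq p q (3 * m + 1)) ∧
      Odd (lucasSeq p q (3 * m + 2)) := by
    intro m
    have step : ∀ m, Even (lucasSeq p q m) → Odd (lucasSeq p q (m + 1)) →
        Odd (lucasSeq p q (m + 2)) := fun m h0 h1 => by
      rw [add_two]
      exact (hp.mul h1).add_even (h0.mul_left _)
    induction m with
    | zero =>
      have h0 : Even (lucasSeq p q 0) := by simp [lucasSeq]
      have h1 : Odd (lucasSeq p q 1) := by simpa [lucasSeq] using hp
      exact ⟨h0, h1, step 0 h0 h1⟩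
    | succ m ih =>
      have h3 : Even (lucasSeq p q (3 * m + 3)) := by
        rw [add_two p q (3 * m + 1)]
        exact (hp.mul ih.2.2).add_odd (hq.mul ih.2.1)
      have h4 : Odd (lucasSeq p q (3 * m + 4)) := by
        rw [add_two p q (3 * m + 2)]
        exact (h3.mul_left _).add_odd (hq.mul ih.2.2)
      exact ⟨h3, h4, step _ h3 h4⟩
  obtain ⟨h0, h1, h2⟩ := key (m / 3)
  have hm : m = 3 * (m / 3) ∨ m = 3 * (m / 3) + 1 ∨ m = 3 * (m / 3) + 2 := by omega
  rcases hm with h | h | h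
  · exact ⟨fun _ => ⟨_, h⟩, fun _ => h ▸ h0⟩
  · rw [← h] at h1
    exact ⟨fun h' => absurd h' (Nat.not_even_iff_odd.2 h1), fun h' => by omega⟩
  · rw [← h] at h2
    exact ⟨fun h' => absurd h' (Nat.not_even_iff_odd.2 h2), fun h' => by omega⟩

/-- Merges conditions (d) and (e) into the single requirement that `L_d` be odd. -/
theorem odd_iff (p q : ℕ) {d : ℕ} (hd : 0 < d) :
    Odd (lucasSeq p q d) ↔ Odd p ∧ (Even q ∨ Odd q ∧ ¬ 3 ∣ d) := by
  rcases Nat.even_or_odd p with hp | hp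
  · have := even_of_even (q := q) hp d
    exact ⟨fun h => absurd this (Nat.not_even_iff_odd.2 h),
      fun h => absurd hp (Nat.not_even_iff_odd.2 h.1)⟩
  rcases Nat.even_or_odd q with hq | hq
  · obtain ⟨d, rfl⟩ := Nat.exists_eq_add_of_le' hd
    exact ⟨fun _ => ⟨hp, Or.inl hq⟩, fun _ => odd_of_even hp hq d⟩
  · rw [← Nat.not_even_iff_odd, even_iff_three_dvd hp hq]
    have := Nat.not_even_iff_odd.2 hq
    tauto

theorem coprime_quotients (hp : 0 < p) (hpq : Nat.Coprime p q) {d r A B : ℕ} (hd : 0 < d)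
    (hr : Odd r) (hA : lucasSeq p q (d * r) = lucasSeq p q d * A)
    (hB : lucasSeq p q (d * (r + 2)) = lucasSeq p q d * B) : Nat.Coprime A B := by
  have hrr : Nat.Coprime r (r + 2) := by
    rw [Nat.coprime_self_add_right]
    exact hr.coprime_two_right
  rcases gcd_mul_mul hpq hd _ r (r + 2) rfl hrr with ⟨_, _, h⟩ | ⟨h, _⟩
  · rw [hA, hB, Nat.gcd_mul_left] at h
    exact Nat.eq_of_mul_eq_mul_left (pos (q := q) hp d) (by rw [h, mul_one])
  · exact absurd ⟨hr, hr.add_even even_two⟩ h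

theorem coprime_mul_even (hpq : Nat.Coprime p q) {d s : ℕ} (hd : 0 < d) (hs : Even s)
    (hP : Odd (lucasSeq p q d)) : Nat.Coprime (lucasSeq p q d) (lucasSeq p q (d * s)) := by
  have h2 := (gcd_mul_mul hpq hd _ 1 s rfl (Nat.coprime_one_left _)).resolve_left
    fun h => Nat.not_even_iff_odd.2 h.2.1 hs
  rw [mul_one] at h2
  exact Nat.eq_one_of_dvd_coprimes (Nat.coprime_two_left.2 hP) h2.2 (Nat.gcd_dvd_left _ _)

/-- For even `L_d` and odd `q` the quotients `L_{dr} / L_d` with `r` odd are odd. -/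
theorem odd_quotient (hp : 0 < p) {d : ℕ} (hd : Even d) (hP : Even (lucasSeq p q d)) (hq : Odd q)
    {r : ℕ} (hr : Odd r) {A : ℕ} (hA : lucasSeq p q (d * r) = lucasSeq p q d * A) : Odd A := by
  have hall : ∀ i, Even (lucasSeq p q (i * d)) := by
    intro i
    induction i using Nat.twoStepInduction with
    | zero => simp [lucasSeq]
    | one => simpa using hP
    | more i h0 h1 =>
      have h := progression_of_even p q 0 hd i
      simp only [zero_add] at h
      have h2 : Even (lucasSeq p q ((i + 2) * d) + q ^ d * lucasSeq p q (i * d)) :=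
        h ▸ hP.mul_right _
      exact (Nat.even_add.1 h2).2 (h0.mul_left _)
  obtain ⟨s, rfl⟩ := hr
  induction s generalizing A with
  | zero =>
    have : A = 1 := by
      have h1 : lucasSeq p q d * 1 = lucasSeq p q d * A := by simpa using hA
      exact (Nat.eq_of_mul_eq_mul_left (pos hp d) h1).symm
    exact this ▸ odd_one
  | succ s ih =>
    obtain ⟨B, hB⟩ := dvd_mul_of_odd p q d (r := 2 * s + 1) (by simp)
    have hBo := ih hB
    have h := progression_of_even p q 0 hd (2 * s + 1)
    have e1 : 0 + (2 * s + 1 + 2) * d = d * (2 * (s + 1) + 1) := by ring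
    have e2 : 0 + (2 * s + 1) * d = d * (2 * s + 1) := by ring
    rw [e1, e2, hA, hB] at h
    -- The recurrence divided by `L_d`: consecutive odd quotients have an even weighted sum, so
    -- parity propagates.
    have h3 : lucasSeq p q (0 + (2 * s + 1 + 1) * d) = A + q ^ d * B := by
      refine Nat.eq_of_mul_eq_mul_left (pos (q := q) hp d) ?_
      rw [h]
      ring
    have h4 : Even (A + q ^ d * B) := by
      rw [← h3, zero_add]
      exact hall _
    rw [Nat.even_add'] at h4
    exact h4.2 (hq.pow.mul hBo)

end lucasSeq

/-! ### The two families applied to Lucas numbers. -/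

open lucasSeq in
theorem toricIdeal_lucasSeq_of_two (k : Type*) [Field k] {p q : ℕ} (hp : 0 < p) {a d n : ℕ}
    (hn : 2 ≤ n) (h : ∀ i, ∃ u v, u * lucasSeq p q a + v * lucasSeq p q (a + d) =
      lucasSeq p q (a + (i + 2) * d)) :
    (toricIdeal k fun i : Fin n => lucasSeq p q (a + (i : ℕ) * d)).IsCompleteIntersection := by
  obtain ⟨m, rfl⟩ := Nat.exists_eq_add_of_le' hn
  refine toricIdeal_isCompleteIntersection_of_two (fun i => pos hp _) fun i => ?_
  obtain ⟨u, v, huv⟩ := h i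
  exact ⟨u, v, by simpa using huv⟩

open lucasSeq in
theorem toricIdeal_lucasSeq_of_gluing (k : Type*) [Field k] {p q : ℕ} (hp : 0 < p)
    (hpq : Nat.Coprime p q) {d r : ℕ} (hd : Even d) (hd0 : 0 < d) (hr : Odd r)
    (hP : Odd (lucasSeq p q d)) :
    (toricIdeal k fun i : Fin 3 =>
      lucasSeq p q (d * r + (i : ℕ) * d)).IsCompleteIntersection := by
  have hr2 : Odd (r + 2) := by
    rw [Nat.odd_iff] at hr ⊢
    omega
  obtain ⟨A, hA⟩ := dvd_mul_of_odd p q d hr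
  obtain ⟨B, hB⟩ := dvd_mul_of_odd p q d hr2
  have hAB : Nat.Coprime A B := coprime_quotients hp hpq hd0 hr hA hB
  refine toricIdeal_isCompleteIntersection_of_gluing (P := lucasSeq p q d) (Q := q ^ d)
    (A := A) (B := B) (fun i => pos hp _) ?_ ?_ ?_ ?_ hAB
  · simpa [mul_comm] using hA
  · have e : d * r + 2 * d = d * (r + 2) := by ring
    simp only [Fin.val_two, e, hB]
    ring
  · have := progression_of_even p q (d * r) hd 0
    simpa using this
  · have e : d * r + 1 * d = d * (r + 1) := by ring
    simp only [Fin.val_one, e]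
    exact coprime_mul_even hpq hd0 hr.add_one hP

/-! ### Gcd estimates for the necessary conditions. -/

namespace lucasSeq

variable {p q : ℕ}

/-- If the gcd is `L_g`, then `d + g ≤ a`. For even `g`, equality is precisely what condition (c)
describes; for odd `g` it is harmless, since then `L_g L_d < L_{d+g}`. -/
theorem mul_gcd_lt (hp : 0 < p) (hq : 0 < q) (hpq : Nat.Coprime p q) {a d : ℕ} (hd : 0 < d)
    (hde : Even d) (had : d < a)
    (hc : ¬ ((Nat.gcd a d : ℤ) = (a : ℤ) - (d : ℤ) ∧
        padicValNat 2 a < padicValNat 2 d ∧ 1 ≤ padicValNat 2 a)) :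
    lucasSeq p q d * Nat.gcd (lucasSeq p q a) (lucasSeq p q (a + d)) < lucasSeq p q a := by
  have hgcd : Nat.gcd a (a + d) = Nat.gcd a d := by simp
  have hg0 : 0 < Nat.gcd a d := Nat.gcd_pos_of_pos_right _ hd
  rcases gcd_eq (n := a + d) hpq (show 0 < a by omega) with
    ⟨r, s, hr, hs, hro, hso, h⟩ | ⟨r, s, hr, hs, hrs, h⟩
  · rw [hgcd] at hr hs h
    rw [h]
    set g := Nat.gcd a d with hg
    have hrs : r ≤ s := Nat.le_of_mul_le_mul_left (by omega) hg0
    obtain ⟨e, rfl⟩ := Nat.exists_eq_add_of_le hrs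
    have hde' : d = g * e := by
      have : g * (r + e) = g * r + g * e := by ring
      omega
    have heo : Even e := by
      rw [Nat.odd_iff] at hro hso
      rw [Nat.even_iff]
      omega
    have her : e < r := by
      refine Nat.lt_of_mul_lt_mul_left (a := g) ?_
      omega
    have he0 : 0 < e := Nat.pos_of_ne_zero fun h0 => by rw [h0, mul_zero] at hde'; omega
    have hga : d + g ≤ a := by
      have := Nat.mul_le_mul_left g her
      rw [Nat.mul_succ] at this
      omega
    have hgd : g ≤ d := hde' ▸ Nat.le_mul_of_pos_right g he0
    rcases Nat.even_or_odd g with hge | hgo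
    · have hae : Even a := hr ▸ hge.mul_right _
      have hne : d + g ≠ a := by
        intro heq
        apply hc
        have hae' : a = g * (e + 1) := by rw [Nat.mul_succ]; omega
        have : Fact (Nat.Prime 2) := ⟨Nat.prime_two⟩
        refine ⟨by omega, ?_, one_le_padicValNat_of_dvd (by omega) hae.two_dvd⟩
        rw [hae', padicValNat.mul hg0.ne' (by omega)]
        conv_rhs => rw [hde', padicValNat.mul hg0.ne' he0.ne']
        have h1 : padicValNat 2 (e + 1) = 0 := by
          refine padicValNat.eq_zero_of_not_dvd ?_
          rw [Nat.even_iff] at heo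
          omega
        have h2 := one_le_padicValNat_of_dvd he0.ne' heo.two_dvd
        omega
      rw [Nat.even_iff] at hge hae hde
      exact mul_lt hp hq hd hg0 (by omega) (by omega) (by omega)
    · refine lt_of_lt_of_le ?_ (le_of_le hp hq (by omega) hga)
      obtain ⟨t, ht⟩ := Nat.exists_eq_add_of_le hgd
      have h1 := mul_add_of_odd p q hgo t
      have e1 : 2 * g + t = d + g := by omega
      rw [← ht, e1] at h1
      have h2 : 0 < q ^ g * lucasSeq p q t := Nat.mul_pos (pow_pos hq _) (pos hp _)
      rw [mul_comm]
      omega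
  · have ha2 : d + 2 ≤ a := by
      by_contra hlt
      have ha1 : a = d + 1 := by omega
      apply hrs
      have hg1 : Nat.gcd a (a + d) = 1 := by
        rw [hgcd, ha1]
        simp
      rw [hg1, one_mul] at hr hs
      rw [Nat.even_iff] at hde
      rw [Nat.odd_iff, Nat.odd_iff]
      omega
    have h1 := Nat.le_of_dvd two_pos h
    have h2 := two_mul_lt (p := p) (q := q) hp hq (by omega) ha2
    have h3 := Nat.mul_le_mul_left (lucasSeq p q d) h1
    omega

/-- Two odd multiples of `g` differ by an even multiple, so `g` is at most half the distance of the
indices. -/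
theorem gcd_progression (hpq : Nat.Coprime p q) {a d : ℕ} (ha : 0 < a) (hde : Even d)
    {i j : ℕ} (hij : i < j) :
    Nat.gcd (lucasSeq p q (a + i * d)) (lucasSeq p q (a + j * d)) ≤ 2 ∨
    ∃ g, Nat.gcd (lucasSeq p q (a + i * d)) (lucasSeq p q (a + j * d)) = lucasSeq p q g ∧
      0 < g ∧ g % 2 = a % 2 ∧ (∃ r, Odd r ∧ a + i * d = g * r) ∧ 2 * g ∣ (j - i) * d := by
  rcases gcd_eq (p := p) (q := q) (m := a + i * d) (n := a + j * d) hpq (by omega) with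
    ⟨r, s, hr, hs, hro, hso, h⟩ | ⟨r, s, hr, hs, hrs, h⟩
  swap
  · exact Or.inl (Nat.le_of_dvd two_pos h)
  right
  have hg0 : 0 < Nat.gcd (a + i * d) (a + j * d) := Nat.gcd_pos_of_pos_left _ (by omega)
  set g := Nat.gcd (a + i * d) (a + j * d) with hg
  refine ⟨g, h, hg0, ?_, ⟨r, hro, hr⟩, ?_⟩
  · have h1 : (a + i * d) % 2 = (g * r) % 2 := congrArg (· % 2) hr
    have h2 : (i * d) % 2 = 0 := Nat.even_iff.1 (hde.mul_left _)
    rw [Nat.mul_mod, Nat.odd_iff.1 hro] at h1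
    omega
  · obtain ⟨t, rfl⟩ := Nat.exists_eq_add_of_le hij.le
    have h3 : (i + t) * d = i * d + t * d := by ring
    have hrs : r ≤ s := Nat.le_of_mul_le_mul_left (by omega) hg0
    obtain ⟨e, rfl⟩ := Nat.exists_eq_add_of_le hrs
    have heo : Even e := by
      rw [Nat.odd_iff] at hro hso
      rw [Nat.even_iff]
      omega
    obtain ⟨e', rfl⟩ := heo.two_dvd
    refine ⟨e', ?_⟩
    have h4 : g * (r + 2 * e') = g * r + 2 * g * e' := by ring
    rw [Nat.add_sub_cancel_left]
    omega

theorem mul_gcd_progression_lt (hp : 0 < p) (hq : 0 < q) (hpq : Nat.Coprime p q) {a d : ℕ}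
    (ha : 0 < a) (hd : 0 < d) (hde : Even d) {i j : ℕ} (hi : 1 ≤ i) (hij : i < j) :
    lucasSeq p q a * Nat.gcd (lucasSeq p q (a + i * d)) (lucasSeq p q (a + j * d)) <
      lucasSeq p q (a + j * d) := by
  have hjd : j * d = i * d + (j - i) * d := by
    rw [← Nat.add_mul, Nat.add_sub_cancel' hij.le]
  have hid : 2 ≤ i * d := by
    obtain ⟨d', rfl⟩ := hde.two_dvd
    have := Nat.le_mul_of_pos_left (2 * d') hi
    omega
  have hje : (j * d) % 2 = 0 := Nat.even_iff.1 (hde.mul_left _)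
  rcases gcd_progression (p := p) (q := q) hpq ha hde hij with h | ⟨g, hg, hg0, hga, -, hdvd⟩
  · have h1 := Nat.mul_le_mul_left (lucasSeq p q a) h
    have h2 := two_mul_lt (p := p) (q := q) (n := a + j * d) hp hq ha (by omega)
    omega
  · rw [hg, mul_comm]
    have := Nat.le_of_dvd (Nat.mul_pos (by omega) hd) hdvd
    exact mul_lt hp hq hg0 ha (by omega) (by omega) (by omega)

theorem mul_gcd_progression_lt_or (hp : 0 < p) (hq : 0 < q) (hpq : Nat.Coprime p q) {a d : ℕ}
    (ha : 0 < a) (hd : 0 < d) (hde : Even d) {j : ℕ} (hj : 2 ≤ j) :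
    lucasSeq p q (a + d) * Nat.gcd (lucasSeq p q a) (lucasSeq p q (a + j * d)) <
      lucasSeq p q (a + j * d) ∨
    (j = 2 ∧ (∃ r, Odd r ∧ a = d * r) ∧
      Nat.gcd (lucasSeq p q a) (lucasSeq p q (a + j * d)) = lucasSeq p q d) := by
  have hjd : d + d ≤ j * d := by
    have := Nat.mul_le_mul_right d hj
    omega
  have hje : (j * d) % 2 = 0 := Nat.even_iff.1 (hde.mul_left _)
  have hde' := Nat.even_iff.1 hde
  have hgp := gcd_progression (p := p) (q := q) hpq ha hde (show 0 < j by omega)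
  rw [zero_mul, add_zero, Nat.sub_zero] at hgp
  rcases hgp with h | ⟨g, hg, hg0, hga, ⟨r, hr, har⟩, hdvd⟩
  · left
    have h1 := Nat.mul_le_mul_left (lucasSeq p q (a + d)) h
    have h2 := two_mul_lt (p := p) (q := q) (m := a + d) (n := a + j * d) hp hq (by omega)
      (by omega)
    omega
  · have h2g := Nat.le_of_dvd (Nat.mul_pos (by omega) hd) hdvd
    -- As `2g ≤ jd`, this can fail only for `j = 2` and `g = d`.
    by_cases hgd : g + d < j * d
    · left
      rw [hg, mul_comm]
      exact mul_lt hp hq hg0 (by omega) (by omega) (by omega) (by omega)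
    · right
      have hj2 : j = 2 := by
        by_contra hne
        have := Nat.mul_le_mul_right d (show 3 ≤ j by omega)
        omega
      subst hj2
      have hgd' : g = d := by omega
      subst hgd'
      exact ⟨rfl, ⟨r, hr, har⟩, hg⟩

end lucasSeq

/-! ### Minimal generators and coinciding minimal multiples. -/

theorem AddSubmonoid.mem_closure_image_iff_weight {σ : Type*} (D : σ → ℕ) (M : Set σ) (y : ℕ) :
    y ∈ AddSubmonoid.closure (D '' M) ↔
      ∃ e : σ →₀ ℕ, (∀ j ∉ M, e j = 0) ∧ Finsupp.weight D e = y := by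
  classical
  constructor
  · intro h
    induction h using AddSubmonoid.closure_induction with
    | mem x hx =>
      obtain ⟨i, hi, rfl⟩ := hx
      refine ⟨Finsupp.single i 1, fun j hj => ?_, by simp [Finsupp.weight_single]⟩
      rw [Finsupp.single_apply, if_neg]
      rintro rfl
      exact hj hi
    | zero => exact ⟨0, by simp, by simp⟩
    | add x y _ _ hx hy =>
      obtain ⟨e, he, rfl⟩ := hx
      obtain ⟨e', he', rfl⟩ := hy
      exact ⟨e + e', fun j hj => by simp [he j hj, he' j hj], map_add _ _ _⟩
  · rintro ⟨e, he, rfl⟩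
    rw [Finsupp.weight_apply]
    refine AddSubmonoid.sum_mem _ fun j hj => AddSubmonoid.nsmul_mem _ ?_ _
    refine AddSubmonoid.subset_closure ⟨j, ?_, rfl⟩
    by_contra hjM
    exact Finsupp.mem_support_iff.1 hj (he j hjM)

/-- The indices of the degrees that are not generated by those with smaller index. -/
def minimalIndices {n : ℕ} (D : Fin n → ℕ) : Set (Fin n) :=
  {i | D i ∉ AddSubmonoid.closure (D '' {j | j < i})}

theorem mem_closure_minimalIndices {n : ℕ} (D : Fin n → ℕ) (i : Fin n) :
    D i ∈ AddSubmonoid.closure (D '' minimalIndices D) := by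
  induction i using WellFoundedLT.induction with
  | _ i ih =>
    by_cases hi : i ∈ minimalIndices D
    · exact AddSubmonoid.subset_closure ⟨i, hi, rfl⟩
    · have h : D i ∈ AddSubmonoid.closure (D '' {j | j < i}) := not_not.1 hi
      refine AddSubmonoid.closure_le.2 ?_ h
      rintro _ ⟨j, hj, rfl⟩
      exact ih j hj

/-- In a complete intersection, the minimal multiples of two minimal generators coincide. -/
theorem exists_mul_eq_mul_of_isCompleteIntersection {k : Type*} [Field k] {n : ℕ}
    {D : Fin (n + 1) → ℕ} (hD : ∀ i, 0 < D i)
    (hN : ∀ i ∈ minimalIndices D, ∃ j ∈ minimalIndices D, j ≠ i)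
    (h : (toricIdeal k D).IsCompleteIntersection) :
    ∃ i j, i < j ∧ i ∈ minimalIndices D ∧ j ∈ minimalIndices D ∧
      ∃ c c', 0 < c ∧ 0 < c' ∧ c * D i = c' * D j ∧
        (∀ b, 0 < b → b * D i ∈ AddSubmonoid.closure (D '' (minimalIndices D \ {i})) → c ≤ b) ∧
        (∀ b, 0 < b → b * D j ∈ AddSubmonoid.closure (D '' (minimalIndices D \ {j})) →
          c' ≤ b) := by
  classical
  rw [toricIdeal_isCompleteIntersection_iff hD] at h
  obtain ⟨s, hs, hcard⟩ := h
  set N := minimalIndices D with hNdef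
  have himage : ∀ i : N, (fun j : N => D j) '' {j | j ≠ i} = D '' (N \ {(i : Fin (n + 1))}) := by
    intro i
    ext y
    constructor
    · rintro ⟨j, hj, rfl⟩
      exact ⟨j, ⟨j.2, fun h' => hj (Subtype.ext h')⟩, rfl⟩
    · rintro ⟨j, ⟨hj, hji⟩, rfl⟩
      exact ⟨⟨j, hj⟩, fun h' => hji (congrArg Subtype.val h'), rfl⟩
  have hiff : ∀ (i : N) y, y ∈ AddSubmonoid.closure (D '' (N \ {(i : Fin (n + 1))})) ↔
      ∃ e : N →₀ ℕ, e i = 0 ∧ Finsupp.weight (fun j : N => D j) e = y := by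
    intro i y
    rw [← himage, AddSubmonoid.mem_closure_image_iff_weight]
    simp
  have hex : ∀ i : N, ∃ c, 0 < c ∧
      c * D i ∈ AddSubmonoid.closure (D '' (N \ {(i : Fin (n + 1))})) := by
    intro i
    obtain ⟨j, hj, hji⟩ := hN i i.2
    have hmem : D j ∈ D '' (N \ {(i : Fin (n + 1))}) := Set.mem_image_of_mem D ⟨hj, hji⟩
    refine ⟨D j, hD j, ?_⟩
    rw [mul_comm, ← smul_eq_mul]
    exact AddSubmonoid.nsmul_mem _ (AddSubmonoid.subset_closure hmem) _
  by_contra hcon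
  have hle : Fintype.card (Fin (n + 1)) ≤ s.card := by
    refine curveHom.card_le_of_span_eq (k := k) hD N ?_ (fun i => Nat.find (hex i))
      (fun i => (Nat.find_spec (hex i)).1) (fun i => (hiff i _).1 (Nat.find_spec (hex i)).2)
      ?_ ?_ s hs
    · intro i _
      have hi := mem_closure_minimalIndices D i
      have : D '' minimalIndices D = (fun j : N => D j) '' Set.univ := by
        rw [Set.image_univ]
        ext y
        simp [hNdef]
      rw [this, AddSubmonoid.mem_closure_image_iff_weight] at hi
      obtain ⟨e, -, he⟩ := hi
      exact ⟨e, he⟩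
    · intro i b hb hbc he
      exact Nat.find_min (hex i) hbc ⟨hb, (hiff i _).2 he⟩
    · intro i j hij heq
      have hlt : ∀ i j : N, (i : Fin (n + 1)) < j →
          Nat.find (hex i) * D i = Nat.find (hex j) * D j → False := fun i j hij heq =>
        hcon ⟨i, j, hij, i.2, j.2, Nat.find (hex i), Nat.find (hex j),
          (Nat.find_spec (hex i)).1, (Nat.find_spec (hex j)).1, heq,
          fun b hb hb' => Nat.find_min' (hex i) ⟨hb, hb'⟩,
          fun b hb hb' => Nat.find_min' (hex j) ⟨hb, hb'⟩⟩
      rcases lt_trichotomy (i : Fin (n + 1)) j with h1 | h1 | h1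
      · exact hlt i j h1 heq
      · exact hij (Subtype.ext h1)
      · exact hlt j i h1 heq.symm
  rw [Fintype.card_fin] at hle
  omega

theorem AddSubmonoid.mem_closure_triple {a b c y : ℕ} (h : y ∈ AddSubmonoid.closure {a, b, c}) :
    ∃ u v w : ℕ, y = u * a + v * b + w * c := by
  induction h using AddSubmonoid.closure_induction with
  | mem x hx =>
    rcases hx with rfl | rfl | rfl
    · exact ⟨1, 0, 0, by ring⟩
    · exact ⟨0, 1, 0, by ring⟩
    · exact ⟨0, 0, 1, by ring⟩
  | zero => exact ⟨0, 0, 0, by ring⟩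
  | add x y _ _ hx hy =>
    obtain ⟨u, v, w, rfl⟩ := hx
    obtain ⟨u', v', w', rfl⟩ := hy
    exact ⟨u + u', v + v', w + w', by ring⟩

/-! ### Necessity of the conditions, and the equivalence. -/

open lucasSeq in
theorem not_isCompleteIntersection_lucasSeq (k : Type*) [Field k] {p q : ℕ} (hp : 0 < p)
    (hq : 0 < q) (hpq : Nat.Coprime p q) {a d n : ℕ} (hd : 0 < d) (hde : Even d) (had : d < a)
    (hX : lucasSeq p q d * Nat.gcd (lucasSeq p q a) (lucasSeq p q (a + d)) < lucasSeq p q a)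
    (hodd : ∀ r, Odd r → a = d * r → Odd (lucasSeq p q d) → 1 ≤ n) :
    ¬ (toricIdeal k fun i : Fin (n + 3) =>
      lucasSeq p q (a + (i : ℕ) * d)).IsCompleteIntersection := by
  intro hCI
  have ha : 0 < a := by omega
  set P := lucasSeq p q d with hP
  set Q := q ^ d with hQ
  have hP0 : 0 < P := pos hp _
  have hQ0 : 0 < Q := pow_pos hq _
  set f : ℕ → ℕ := fun i => lucasSeq p q (a + i * d) with hf
  have hf0 : f 0 = lucasSeq p q a := by simp [hf]
  have hf1 : f 1 = lucasSeq p q (a + d) := by simp [hf]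
  have hfpos : ∀ i, 0 < f i := fun i => pos hp _
  have hrec : ∀ i, P * f (i + 1) = f (i + 2) + Q * f i := fun i => progression_of_even p q a hde i
  rw [← hf0, ← hf1] at hX
  set D : Fin (n + 3) → ℕ := fun i => f i with hDdef
  set N := minimalIndices D with hN
  set i0 : Fin (n + 3) := ⟨0, by omega⟩ with hi0
  set i1 : Fin (n + 3) := ⟨1, by omega⟩ with hi1
  set i2 : Fin (n + 3) := ⟨2, by omega⟩ with hi2
  have h0N : i0 ∈ N := by
    intro h
    have : {j : Fin (n + 3) | j < i0} = ∅ := by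
      ext j
      simp [hi0]
    rw [this, Set.image_empty, AddSubmonoid.closure_empty, AddSubmonoid.mem_bot] at h
    exact (hfpos 0).ne' h
  have h1N : i1 ∈ N := by
    intro h
    have : {j : Fin (n + 3) | j < i1} = {i0} := by
      ext j
      simp only [Set.mem_ofPred_eq, Set.mem_singleton_iff, Fin.lt_def, Fin.ext_iff, hi0, hi1]
      omega
    rw [this, Set.image_singleton, AddSubmonoid.mem_closure_singleton] at h
    obtain ⟨u, hu⟩ := h
    have hdvd : f 0 ∣ f 1 := ⟨u, by rw [mul_comm]; exact hu.symm⟩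
    rw [Nat.gcd_eq_left hdvd] at hX
    exact absurd hX (not_lt.2 (Nat.le_mul_of_pos_left _ hP0))
  have h2N : i2 ∈ N := by
    intro h
    have : {j : Fin (n + 3) | j < i2} = {i0, i1} := by
      ext j
      simp only [Set.mem_ofPred_eq, Set.mem_insert_iff, Set.mem_singleton_iff, Fin.lt_def,
        Fin.ext_iff, hi0, hi1, hi2]
      omega
    rw [this, Set.image_pair, AddSubmonoid.mem_closure_pair] at h
    obtain ⟨u, v, huv⟩ := h
    have huv' : u * f 0 + v * f 1 = f 2 := huv
    have h1 := hrec 0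
    have h2 : (u + Q) * f 0 + v * f 1 = P * f 1 := by
      rw [h1, ← huv']
      ring
    have hvP : v < P := by
      refine Nat.lt_of_mul_lt_mul_right (a := f 1) ?_
      have : 0 < (u + Q) * f 0 := Nat.mul_pos (by omega) (hfpos 0)
      omega
    -- A relation `f 2 = u f 0 + v f 1` gives `(P - v) f 1 = (u + Q) f 0`, so `f 0` divides `(P - v)
    -- gcd(f 0, f 1)`, too small by `hX`.
    obtain ⟨w, hw⟩ := Nat.exists_eq_add_of_le hvP.le
    have hw0 : 0 < w := by omega
    have h3 : w * f 1 = (u + Q) * f 0 := by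
      rw [hw, Nat.add_mul v w] at h2
      omega
    have h4 : f 0 ∣ w * Nat.gcd (f 0) (f 1) := by
      rw [← Nat.gcd_mul_left]
      exact Nat.dvd_gcd (dvd_mul_left _ _) (h3 ▸ dvd_mul_left _ _)
    have h5 := Nat.le_of_dvd (Nat.mul_pos hw0 (Nat.gcd_pos_of_pos_left _ (hfpos 0))) h4
    have h6 := Nat.mul_le_mul_right (Nat.gcd (f 0) (f 1)) (show w ≤ P by omega)
    omega
  have hmem : ∀ {i j : Fin (n + 3)}, j ∈ N → j ≠ i → ∀ b,
      b * f j ∈ AddSubmonoid.closure (D '' (N \ {i})) := fun {i j} hj hji b => by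
    have hmem : D j ∈ D '' (N \ {i}) := Set.mem_image_of_mem D ⟨hj, hji⟩
    rw [← smul_eq_mul]
    exact AddSubmonoid.nsmul_mem _ (AddSubmonoid.subset_closure hmem) _
  have hne01 : i0 ≠ i1 := by simp [hi0, hi1]
  have hne02 : i0 ≠ i2 := by simp [hi0, hi2]
  have hne12 : i1 ≠ i2 := by simp [hi1, hi2]
  obtain ⟨i, j, hij, hiN, hjN, c, c', hc, hc', heq, hmin, hmin'⟩ :=
    exists_mul_eq_mul_of_isCompleteIntersection (D := D) (fun i => hfpos i)
      (fun i _ => by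
        by_cases hi : i = i0
        · exact ⟨i1, h1N, hi ▸ hne01.symm⟩
        · exact ⟨i0, h0N, Ne.symm hi⟩) hCI
  have heq' : c * f i = c' * f j := heq
  have hboundj : f j ≤ c * Nat.gcd (f i) (f j) := by
    refine Nat.le_of_dvd (Nat.mul_pos hc (Nat.gcd_pos_of_pos_left _ (hfpos _))) ?_
    rw [← Nat.gcd_mul_left]
    exact Nat.dvd_gcd (heq' ▸ dvd_mul_left _ _) (dvd_mul_left _ _)
  have hboundi : f i ≤ c' * Nat.gcd (f i) (f j) := by
    refine Nat.le_of_dvd (Nat.mul_pos hc' (Nat.gcd_pos_of_pos_left _ (hfpos _))) ?_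
    rw [← Nat.gcd_mul_left]
    exact Nat.dvd_gcd (dvd_mul_left _ _) (heq' ▸ dvd_mul_left _ _)
  have hij' : (i : ℕ) < j := hij
  -- Otherwise the trivial relation `f 0 * f i = f i * f 0` gives `c ≤ f 0`, too small for a common
  -- multiple of `f i` and `f j`.
  have hiz : (i : ℕ) = 0 := by
    by_contra hi
    have h1 := mul_gcd_progression_lt (p := p) (q := q) hp hq hpq ha hd hde
      (i := i) (j := j) (by omega) hij'
    have h2 : c ≤ f 0 := by
      refine hmin _ (hfpos 0) ?_
      change f 0 * f i ∈ _
      rw [mul_comm]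
      exact hmem h0N (fun h => hi (by rw [← h])) _
    have h3 := Nat.mul_le_mul_right (Nat.gcd (f i) (f j)) h2
    rw [hf0] at h3
    exact absurd (hboundj.trans h3) (not_le.2 h1)
  have hi : i = i0 := Fin.ext hiz
  subst hi
  have hboundj : f j ≤ c * Nat.gcd (f 0) (f j) := hboundj
  have hboundi : f 0 ≤ c' * Nat.gcd (f 0) (f j) := hboundi
  have hj2 : 2 ≤ (j : ℕ) := by
    by_contra hj
    have hj1 : j = i1 := Fin.ext (by simp only [hi1]; omega)
    subst hj1
    have h1 : c' ≤ P := by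
      refine hmin' _ hP0 ?_
      change P * f 1 ∈ _
      rw [hrec 0]
      refine add_mem ?_ (hmem (i := i1) h0N hne01 Q)
      have := hmem (i := i1) h2N hne12.symm 1
      rwa [one_mul] at this
    have h2 := Nat.mul_le_mul_right (Nat.gcd (f 0) (f 1)) h1
    exact absurd (hboundi.trans h2) (not_le.2 hX)
  have hcf1 : c ≤ f 1 := by
    refine hmin _ (hfpos 1) ?_
    change f 1 * f 0 ∈ _
    rw [mul_comm]
    exact hmem (i := i0) h1N hne01.symm _
  rcases mul_gcd_progression_lt_or (p := p) (q := q) hp hq hpq ha hd hde hj2 with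
    h | ⟨hj, ⟨r, hr, har⟩, hgcd⟩
  · have h1 := Nat.mul_le_mul_right (Nat.gcd (f 0) (f j)) hcf1
    rw [hf1, hf0] at h1
    rw [hf0] at hboundj
    exact absurd (hboundj.trans h1) (not_le.2 h)
  have hj' : j = i2 := Fin.ext hj
  subst hj'
  have hgcd' : Nat.gcd (f 0) (f 2) = P := by rw [hf0]; exact hgcd
  change f 0 ≤ c' * Nat.gcd (f 0) (f 2) at hboundi
  rw [hgcd'] at hboundi
  have hr3 : 3 ≤ r := by
    have h1 : 1 < r := by
      refine Nat.lt_of_mul_lt_mul_left (a := d) ?_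
      omega
    rw [Nat.odd_iff] at hr
    omega
  have hf0r : f 0 = lucasSeq p q (d * r) := by rw [hf0, har]
  have hf2r : f 2 = lucasSeq p q (d * (r + 2)) := by
    simp only [hf]
    congr 1
    rw [har]
    ring
  have hr2 : Odd (r + 2) := hr.add_even even_two
  obtain ⟨A, hA⟩ := dvd_mul_of_odd p q d hr
  obtain ⟨B, hB⟩ := dvd_mul_of_odd p q d hr2
  have hAB := coprime_quotients hp hpq hd hr hA hB
  have hfA : f 0 = P * A := hf0r.trans hA
  have hfB : f 2 = P * B := hf2r.trans hB
  have hPA : P * P < f 0 := by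
    rw [hf0]
    have hde' := Nat.even_iff.1 hde
    have hae : a % 2 = 0 := Nat.even_iff.1 (har ▸ hde.mul_right _)
    refine mul_lt hp hq hd hd (by omega) (by omega) ?_
    have := Nat.mul_le_mul_left d hr3
    omega
  have hPA' : P < A := Nat.lt_of_mul_lt_mul_left (hfA ▸ hPA)
  have hAc : A ≤ c' := by
    rw [hfA, mul_comm] at hboundi
    exact Nat.le_of_mul_le_mul_right hboundi hP0
  have hrec0 : P * f 1 = f 2 + Q * f 0 := hrec 0
  have hrec1 : P * f 2 = f 3 + Q * f 1 := hrec 1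
  -- It remains to find a multiplier for `f 2` below `A`, against `hAc`. For even `P` halving the
  -- relations gives `(A + 1) / 2`; for odd `P` the fourth degree `f 3` is needed.
  rcases Nat.even_or_odd P with hPe | hPo
  · have hqo : Odd q := by
      have := coprime_q hpq (m := d) hd
      exact Nat.coprime_two_left.1 (this.coprime_dvd_left hPe.two_dvd)
    have hAo := odd_quotient hp hde hPe hqo hr hA
    have hBo := odd_quotient hp hde hPe hqo hr2 hB
    have hQo : Odd Q := hqo.pow
    have hQB : Q ≤ B := by
      refine Nat.le_of_mul_le_mul_right ?_ hP0
      have h1 := pow_mul_le p q d d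
      have h2 : lucasSeq p q (2 * d + d) ≤ f 2 := by
        refine le_of_le hp hq (by omega) ?_
        omega
      rw [mul_comm B, ← hfB]
      exact h1.trans h2
    obtain ⟨u, hu⟩ := hAo
    obtain ⟨x, hx⟩ : ∃ x, B = Q + 2 * x := by
      refine ⟨(B - Q) / 2, ?_⟩
      rw [Nat.odd_iff] at hBo hQo
      omega
    obtain ⟨y, hy⟩ := hPe.two_dvd
    have hf1' : f 1 = B + Q * A := by
      refine Nat.eq_of_mul_eq_mul_left hP0 ?_
      rw [hrec0, hfA, hfB]
      ring
    have h1 : c' ≤ u + 1 := by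
      refine hmin' _ (by omega) ?_
      have : (u + 1) * f 2 = x * f 0 + y * f 1 := by
        rw [hfB, hfA, hf1', hy, hx, hu]
        ring
      change (u + 1) * f 2 ∈ _
      rw [this]
      exact add_mem (hmem (i := i2) h0N hne02 x) (hmem (i := i2) h1N hne12 y)
    omega
  · have hn := hodd r hr har hPo
    set i3 : Fin (n + 3) := ⟨3, by omega⟩ with hi3
    by_cases h3N : i3 ∈ N
    · have h1 : c' ≤ P := by
        refine hmin' _ hP0 ?_
        change P * f 2 ∈ _
        rw [hrec1]
        refine add_mem ?_ (hmem (i := i2) h1N hne12 Q)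
        have := hmem (i := i2) h3N (by simp [hi2, hi3]) 1
        rwa [one_mul] at this
      omega
    · have h := not_not.1 h3N
      have hset : {j : Fin (n + 3) | j < i3} = {i0, i1, i2} := by
        ext j
        simp only [Set.mem_ofPred_eq, Set.mem_insert_iff, Set.mem_singleton_iff, Fin.lt_def,
          Fin.ext_iff, hi0, hi1, hi2, hi3]
        omega
      rw [hset, Set.image_insert_eq, Set.image_pair] at h
      obtain ⟨x, y, z, hxyz⟩ := AddSubmonoid.mem_closure_triple h
      have hxyz : f 3 = x * f 0 + y * f 1 + z * f 2 := hxyz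
      have h1 : P * f 2 = x * f 0 + (y + Q) * f 1 + z * f 2 := by
        rw [hrec1, hxyz]
        ring
      have hPf1 : Nat.Coprime P (f 1) := by
        have : f 1 = lucasSeq p q (d * (r + 1)) := by
          rw [hf1, har]
          congr 1
        rw [this]
        exact coprime_mul_even hpq hd hr.add_one hPo
      have h2 : P ∣ (y + Q) * f 1 := by
        have e : x * f 0 + (y + Q) * f 1 + z * f 2 = P * (x * A + z * B) + (y + Q) * f 1 := by
          rw [hfA, hfB]
          ring
        rw [e] at h1
        exact (Nat.dvd_add_right (dvd_mul_right _ _)).1 (h1 ▸ dvd_mul_right _ _)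
      -- With `y + Q = P t`, the recurrence trades `f 1` for `f 0` and `f 2`; coprimality of `A` and
      -- `B` then makes `A` divide `P - t - z`, a positive number below `A`.
      obtain ⟨t, ht⟩ := hPf1.dvd_of_dvd_mul_right h2
      have ht0 : 0 < t := Nat.pos_of_ne_zero fun h0 => by rw [h0, mul_zero] at ht; omega
      have h3 : P * B = (x + t * Q) * A + (t + z) * B := by
        refine Nat.eq_of_mul_eq_mul_left hP0 ?_
        have e : (y + Q) * f 1 = t * (f 2 + Q * f 0) := by
          rw [ht, ← hrec0]
          ring
        rw [e, hfA, hfB] at h1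
        rw [h1]
        ring
      have hA0 : 0 < A := by omega
      have hpos : 0 < (x + t * Q) * A :=
        Nat.mul_pos (Nat.add_pos_right _ (Nat.mul_pos ht0 hQ0)) hA0
      have hlt : t + z < P := by
        refine Nat.lt_of_mul_lt_mul_right (a := B) ?_
        omega
      obtain ⟨w, hw⟩ := Nat.exists_eq_add_of_le hlt.le
      have h4 : w * B = (x + t * Q) * A := by
        rw [hw, Nat.add_mul] at h3
        omega
      have h5 : A ∣ w := hAB.dvd_of_dvd_mul_right (h4 ▸ dvd_mul_left _ _)
      have h6 := Nat.le_of_dvd (by omega) h5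
      omega

theorem mainTheorem4 (k : Type*) [Field k] (p q : ℕ) (hp : 0 < p) (hq : 0 < q)
    (hpq : Nat.Coprime p q) (a d n : ℕ) (ha : 0 < a) (hd : 0 < d) (hn : 3 ≤ n) :
    (toricIdeal k fun i : Fin n => lucasSeq p q (a + (i : ℕ) * d)).IsCompleteIntersection ↔
      Odd d ∨
      a ≤ d ∨
      ((Nat.gcd a d : ℤ) = (a : ℤ) - (d : ℤ) ∧
        padicValNat 2 a < padicValNat 2 d ∧ 1 ≤ padicValNat 2 a) ∨
      (n = 3 ∧ Odd p ∧ (d ∣ a ∧ Odd (a / d)) ∧ Even q) ∨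
      (n = 3 ∧ ¬ 3 ∣ d ∧ Odd p ∧ Odd q ∧ (d ∣ a ∧ Odd (a / d))) := by
  constructor
  · intro hCI
    by_contra hcon
    push Not at hcon
    obtain ⟨hdo, had, hc, h4, h5⟩ := hcon
    have hde : Even d := Nat.not_odd_iff_even.1 hdo
    obtain ⟨m, rfl⟩ := Nat.exists_eq_add_of_le' hn
    refine not_isCompleteIntersection_lucasSeq k hp hq hpq hd hde had
      (lucasSeq.mul_gcd_lt hp hq hpq hd hde had (fun h => ?_)) ?_ hCI
    · have := hc h.1 h.2.1
      omega
    · intro r hr har hP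
      by_contra hm
      have hm3 : m + 3 = 3 := by omega
      have hda : d ∣ a ∧ Odd (a / d) := by
        rw [har]
        exact ⟨dvd_mul_right _ _, by rwa [Nat.mul_div_cancel_left _ hd]⟩
      rw [lucasSeq.odd_iff p q hd] at hP
      obtain ⟨hpo, hqe | ⟨hqo, h3⟩⟩ := hP
      · exact absurd hqe (h4 hm3 hpo hda)
      · exact h5 hm3 h3 hpo hqo hda.1 hda.2
  · intro h
    rcases Nat.even_or_odd d with hde | hdo
    swap
    · exact toricIdeal_lucasSeq_of_two k hp (by omega)
        fun i => lucasSeq.exists_of_odd p q a hdo (i + 2)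
    have hgl : n = 3 → d ∣ a → Odd (a / d) → Odd (lucasSeq p q d) →
        (toricIdeal k fun i : Fin n =>
          lucasSeq p q (a + (i : ℕ) * d)).IsCompleteIntersection := by
      rintro rfl ⟨r, rfl⟩ hr hP
      rw [Nat.mul_div_cancel_left _ hd] at hr
      exact toricIdeal_lucasSeq_of_gluing k hp hpq hde hd hr hP
    rcases h with h | h | ⟨hg, hv, hv1⟩ | ⟨h3, hpo, ⟨hda, hr⟩, hqe⟩ |
      ⟨h3, h3d, hpo, hqo, hda, hr⟩
    · exact absurd hde (Nat.not_even_iff_odd.2 h)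
    · exact toricIdeal_lucasSeq_of_two k hp (by omega)
        (lucasSeq.exists_of_even_of_le hp hq ha hde h)
    · have hg0 : 0 < Nat.gcd a d := Nat.gcd_pos_of_pos_left _ ha
      obtain ⟨e, he⟩ := Nat.gcd_dvd_right a d
      set g := Nat.gcd a d with hgdef
      have hage : a = g * e + g := by omega
      have hae : Even a := even_iff_two_dvd.2 (dvd_of_one_le_padicValNat hv1)
      have : Fact (Nat.Prime 2) := ⟨Nat.prime_two⟩
      have he0 : e ≠ 0 := fun h0 => by rw [h0, mul_zero] at he; omega
      -- As `a = g(e+1)` and `d = ge`, an odd `e` would give `d` the 2-adic valuation of `g`, at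
      -- most that of `a`.
      have hee : Even e := by
        by_contra hne
        rw [Nat.not_even_iff_odd, Nat.odd_iff] at hne
        have h1 : padicValNat 2 e = 0 := padicValNat.eq_zero_of_not_dvd (by omega)
        have h2 : a = g * (e + 1) := by rw [hage]; ring
        rw [h2, padicValNat.mul hg0.ne' (by omega)] at hv
        conv_rhs at hv => rw [he, padicValNat.mul hg0.ne' he0, h1]
        omega
      have hge : Even g := by
        rw [hage] at hae
        exact (Nat.even_add.1 hae).1 (hee.mul_left _)
      have key := fun i => lucasSeq.exists_of_eq_add (p := p) (q := q) hp hq hge hg0 hee i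
      rw [← hage, ← he] at key
      exact toricIdeal_lucasSeq_of_two k hp (by omega) key
    · exact hgl h3 hda hr ((lucasSeq.odd_iff p q hd).2 ⟨hpo, Or.inl hqe⟩)
    · exact hgl h3 hda hr ((lucasSeq.odd_iff p q hd).2 ⟨hpo, Or.inr ⟨hqo, h3d⟩⟩)
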